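/- For a complex manifold $U$ let $\mathcal{HVB}^\nabla(U)$ be the (large) groupoid whose objects are finite-dimensional holomorphic vector bundles $E\to U$ together with a holomorphic connection $\nabla_E$, and whose morphisms are the isomorphisms of holomorphic bundles, which need not respect the connections. Pullback makes $\mathcal{HVB}^\nabla$ a presheaf of groupoids on complex manifolds; let $\mathbf{HVB}(U)$ be the nerve of $\mathcal{HVB}^\nabla(U)$. Let $\Omega^\bullet_{hol}(U)$ be the graded abelian group of holomorphic forms on $U$ with zero differential, and let $\Omega^\bullet_{hol}(U)[u]^{\bullet\le 0}$ be the quotient of $\Omega^\bullet_{hol}(U)\otimes\mathbb Z[u]$, $|u|=-2$, $du=0$, by its components of positive degree. Let $\mathbf\Omega(U)$ be the simplicial set underlying its Dold–Kan simplicial abelian group: its $k$-simplices are the chain maps $N(\mathbb Z\Delta^k)\to\Omega^\bullet_{hol}(U)[u]^{\bullet\le 0}$, where $N(\mathbb Z\Delta^k)$ is the complex of normalized chains of the standard simplex, which has in degree $-\ell$ a generator $e_{i_0,\dots,i_\ell}$ for all $0\le i_0<\dots<i_\ell\le k$. Pullback of forms makes $\mathbf\Omega$ a simplicial presheaf. Given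 a $k$-simplex $E_0\xrightarrow{f_1}E_1\to\dots\xrightarrow{f_k}E_k$ of $\mathbf{HVB}(U)$, write $\tilde f_{q,p}=f_q\circ\dots\circ f_{p+1}:E_p\to E_q$ for $p\le q$, and let $\nabla_{q,p}$ be the connection on $\mathrm{Hom}(E_p,E_q)$ induced by $\nabla_{E_p}$ and $\nabla_{E_q}$. Theorem. There is a unique map of simplicial presheaves $\mathbf{Ch}:\mathbf{HVB}\to\mathbf\Omega$ (a natural transformation of functors from the opposite of the category of complex manifolds to large simplicial sets) such that, for every complex manifold $U$, every $k\ge 0$ and every $k$-simplex as above, the chain map $\mathbf{Ch}(U)_k(E_0\to\dots\to E_k):N(\mathbb Z\Delta^k)\to\Omega^\bullet_{hol}(U)[u]^{\bullet\le 0}$ sends $e_i$ to the fibre dimension $\dim(E_i)$ (a locally constant function) and, for $\ell\ge 1$ and $0\le i_0<\dots<i_\ell\le k$, sends $e_{i_0,\dots,i_\ell}$ to $$\mathrm{tr}\Big(\tilde f_{i_\ell,i_0}^{-1}\circ\nabla_{i_\ell,i_{\ell-1}}(\tilde f_{i_\ell,i_{\ell-1}})\circ\dots\circ\nabla_{i_2,i_1}(\tilde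 f_{i_2,i_1})\circ\nabla_{i_1,i_0}(\tilde f_{i_1,i_0})\Big)\cdot u^\ell ,$$ where $\mathrm{Hom}$-valued $1$-forms are multiplied by composition and wedge product, $(\alpha_1\circ\dots\circ\alpha_\ell)(w_1,\dots,w_\ell)=\sum_{\sigma\in S_\ell}\mathrm{sgn}(\sigma)\,\alpha_1(w_{\sigma(1)})\circ\dots\circ\alpha_\ell(w_{\sigma(\ell)})$. In particular these traces are holomorphic forms, the assignment on generators is a chain map, and it is compatible with faces, degeneracies and pullback. -/

import Mathlib

open CategoryTheory Opposite
open scoped Manifold ContDiff Topology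

universe u

/-! ## Complex manifolds and holomorphic maps -/

/-- Complex manifolds: Hausdorff spaces with a holomorphic (complex analytic) atlas modelled on
`ℂ^dim`. No countability condition is imposed, so that arbitrary disjoint unions (for instance the
Cech nerve of any open cover) are allowed. -/
structure CMan : Type (u + 1) where
  carrier : Type u
  [top : TopologicalSpace carrier]
  [t2 : T2Space carrier]
  dim : ℕ
  [charted : ChartedSpace (EuclideanSpace ℂ (Fin dim)) carrier]
  [mfd : IsManifold 𝓘(ℂ, EuclideanSpace ℂ (Fin dim)) ω carrier]

namespace CMan

instance : CoeSort CMan.{u} (Type u) := ⟨CMan.carrier⟩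

attribute [instance] CMan.top CMan.t2 CMan.charted CMan.mfd

/-- The model space `ℂ^dim`. -/
abbrev Model (U : CMan.{u}) : Type := EuclideanSpace ℂ (Fin U.dim)

/-- The model with corners of `U` (no boundary). -/
noncomputable abbrev I (U : CMan.{u}) : ModelWithCorners ℂ U.Model U.Model := 𝓘(ℂ, U.Model)

/-- Holomorphic maps between complex manifolds. -/
abbrev HolMap (U V : CMan.{u}) : Type u := C^ω⟮U.I, U; V.I, V⟯

/-- The category of complex manifolds and holomorphic maps. -/
noncomputable instance : Category.{u} CMan.{u} where
  Hom U V := HolMap U V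
  id _ := ContMDiffMap.id
  comp f g := ContMDiffMap.comp g f

/-- The (holomorphic) tangent space of `U` at `x`. -/
abbrev T (U : CMan.{u}) (x : U) : Type := TangentSpace U.I x

/-- The function `c` is holomorphic on a neighbourhood of `x`. -/
def HolAt {U : CMan.{u}} (c : U → ℂ) (x : U) : Prop := ContMDiffAt U.I 𝓘(ℂ) ω c x

/-- The vector field `v` is holomorphic on a neighbourhood of `x`. -/
def HolVF {U : CMan.{u}} (v : ∀ y : U, U.T y) (x : U) : Prop :=
  ContMDiffAt U.I U.I.tangent ω (fun y => (⟨y, v y⟩ : TangentBundle U.I U)) x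

/-- The differential `dc` at `x` of a complex function `c`. -/
noncomputable def dFun {U : CMan.{u}} (c : U → ℂ) (x : U) : U.T x →ₗ[ℂ] ℂ :=
  (mvfderiv U.I c x : U.T x →L[ℂ] ℂ)

/-- The differential `dφ` at `x` of a holomorphic map `φ`. -/
noncomputable def dMap {U V : CMan.{u}} (φ : HolMap U V) (x : U) : U.T x →ₗ[ℂ] V.T (φ x) :=
  (mfderiv U.I V.I φ x : U.T x →L[ℂ] V.T (φ x))

section
variable {U V W : CMan.{u}}

theorem HolAt.mdiff {c : U → ℂ} {x : U} (h : HolAt c x) : MDifferentiableAt U.I 𝓘(ℂ) c x :=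
  ContMDiffAt.mdifferentiableAt h (by simp)

theorem HolAt.add {c d : U → ℂ} {x : U} (hc : HolAt c x) (hd : HolAt d x) :
    HolAt (fun y => c y + d y) x := ContMDiffAt.add hc hd

theorem HolAt.mul {c d : U → ℂ} {x : U} (hc : HolAt c x) (hd : HolAt d x) :
    HolAt (fun y => c y * d y) x := ContMDiffAt.mul hc hd

theorem HolAt.sub {c d : U → ℂ} {x : U} (hc : HolAt c x) (hd : HolAt d x) :
    HolAt (fun y => c y - d y) x := ContMDiffAt.sub hc hd

theorem HolAt.const (a : ℂ) (x : U) : HolAt (fun _ : U => a) x := contMDiffAt_const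

theorem HolAt.congr {c d : U → ℂ} {x : U} (hc : HolAt c x) (h : d =ᶠ[𝓝 x] c) : HolAt d x :=
  ContMDiffAt.congr_of_eventuallyEq hc h

theorem HolAt.sum {ι : Type*} (t : Finset ι) {c : ι → U → ℂ} {x : U} (hc : ∀ i, HolAt (c i) x) :
    HolAt (fun y => ∑ i ∈ t, c i y) x := by
  classical
  induction t using Finset.induction_on with
  | empty => simpa using HolAt.const 0 x
  | insert a s ha ih =>
    simp only [Finset.sum_insert ha]
    exact (hc a).add ih

theorem HolAt.prod {ι : Type*} (t : Finset ι) {c : ι → U → ℂ} {x : U} (hc : ∀ i, HolAt (c i) x) :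
    HolAt (fun y => ∏ i ∈ t, c i y) x := by
  classical
  induction t using Finset.induction_on with
  | empty => simpa using HolAt.const 1 x
  | insert a s ha ih =>
    simp only [Finset.prod_insert ha]
    exact (hc a).mul ih

theorem HolAt.comp {c : V → ℂ} (φ : HolMap U V) {x : U} (hc : HolAt c (φ x)) :
    HolAt (fun y => c (φ y)) x :=
  ContMDiffAt.comp x hc φ.contMDiff.contMDiffAt

theorem dFun_congr {c d : U → ℂ} {x : U} (h : c =ᶠ[𝓝 x] d) : dFun c x = dFun d x := by
  ext v
  simp only [dFun, mvfderiv, h.mfderiv_eq]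
  rfl

theorem dFun_const (a : ℂ) (x : U) : dFun (fun _ : U => a) x = 0 := by
  ext v
  simp [dFun, mvfderiv_const]

theorem dFun_add {c d : U → ℂ} {x : U} (hc : HolAt c x) (hd : HolAt d x) :
    dFun (fun y => c y + d y) x = dFun c x + dFun d x := by
  ext v
  exact congrArg (fun L : U.T x →L[ℂ] ℂ => L v) (mvfderiv_add hc.mdiff hd.mdiff)

theorem dFun_mul {c d : U → ℂ} {x : U} (hc : HolAt c x) (hd : HolAt d x) :
    dFun (fun y => c y * d y) x = c x • dFun d x + d x • dFun c x := by
  ext v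
  exact congrArg (fun L : U.T x →L[ℂ] ℂ => L v) (mvfderiv_mul hc.mdiff hd.mdiff)

theorem dFun_sum {ι : Type*} (t : Finset ι) {c : ι → U → ℂ} {x : U} (hc : ∀ i, HolAt (c i) x) :
    dFun (fun y => ∑ i ∈ t, c i y) x = ∑ i ∈ t, dFun (c i) x := by
  classical
  induction t using Finset.induction_on with
  | empty => simpa using dFun_const 0 x
  | insert a s ha ih =>
    simp only [Finset.sum_insert ha]
    rw [dFun_add (hc a) (HolAt.sum s hc), ih]

theorem dFun_comp {c : V → ℂ} (φ : HolMap U V) {x : U} (hc : HolAt c (φ x)) (v : U.T x) :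
    dFun (fun y => c (φ y)) x v = dFun c (φ x) (dMap φ x v) := by
  exact mvfderiv_comp_apply x hc.mdiff
    ((φ.contMDiff.contMDiffAt (x := x)).mdifferentiableAt (by simp)) v

theorem dMap_id (x : U) : dMap (ContMDiffMap.id : HolMap U U) x = LinearMap.id := by
  ext v
  change mfderiv U.I U.I id x v = v
  simp

theorem dMap_comp (ψ : HolMap V W) (φ : HolMap U V) (x : U) (v : U.T x) :
    dMap (ContMDiffMap.comp ψ φ) x v = dMap ψ (φ x) (dMap φ x v) := by
  exact mfderiv_comp_apply x
    ((ψ.contMDiff.contMDiffAt (x := φ x)).mdifferentiableAt (by simp))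
    ((φ.contMDiff.contMDiffAt (x := x)).mdifferentiableAt (by simp)) v

/-- Along a holomorphic map, the image of a holomorphic vector field is, locally, a combination of
holomorphic vector fields of the target with holomorphic coefficients. -/
theorem HolVF.exists_coeff (φ : HolMap U V) {v : ∀ y : U, U.T y} {x : U} (hv : HolVF v x) :
    ∃ (b : Fin V.dim → ∀ y : V, V.T y) (c : Fin V.dim → U → ℂ),
      (∀ j, HolVF (b j) (φ x)) ∧ (∀ j, HolAt (c j) x) ∧
      ∀ᶠ z in 𝓝 x, dMap φ z (v z) = ∑ j, c j z • b j (φ z) := by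
  have : IsManifold V.I 1 V := IsManifold.of_le (n := ω) le_top
  have : IsManifold U.I 1 U := IsManifold.of_le (n := ω) le_top
  let e := trivializationAt V.Model (TangentSpace V.I : V → Type _) (φ x)
  let B := (EuclideanSpace.basisFun (Fin V.dim) ℂ).toBasis
  have hx : φ x ∈ e.baseSet := FiberBundle.mem_baseSet_trivializationAt' (φ x)
  refine ⟨fun j => e.localFrame B j,
    fun j z => B.repr (e (⟨φ z, dMap φ z (v z)⟩ : TangentBundle V.I V)).2 j, ?_, ?_, ?_⟩
  · intro j
    exact contMDiffAt_localFrame_of_mem ω _ B j hx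
  · intro j
    have h1 : ContMDiffAt U.I V.I.tangent ω
        (fun z => (⟨φ z, dMap φ z (v z)⟩ : TangentBundle V.I V)) x := by
      have := (φ.contMDiff.contMDiff_tangentMap (m := ω) le_top).contMDiffAt
        (x := (⟨x, v x⟩ : TangentBundle U.I U))
      exact this.comp x hv
    have h2 := ((Bundle.contMDiffAt_totalSpace).1 h1).2
    let L : V.Model →ₗ[ℂ] ℂ := B.coord j
    have h3 : ContMDiffAt 𝓘(ℂ, V.Model) 𝓘(ℂ) ω (LinearMap.toContinuousLinearMap L)
        (e (⟨φ x, dMap φ x (v x)⟩ : TangentBundle V.I V)).2 :=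
      (ContinuousLinearMap.contDiff _).contMDiff.contMDiffAt
    exact h3.comp x h2
  · have : ∀ᶠ z in 𝓝 x, φ z ∈ e.baseSet :=
      φ.contMDiff.continuous.continuousAt.eventually (e.open_baseSet.mem_nhds hx)
    filter_upwards [this] with z hz
    have := (e.basisAt B hz).sum_repr (dMap φ z (v z))
    rw [← this]
    refine Finset.sum_congr rfl fun j _ => ?_
    rw [e.localFrame_apply_of_mem_baseSet B hz, this]
    congr 1
end
end CMan

/-! ## Holomorphic vector bundles

A holomorphic vector bundle on `U` is given by its fibres together with its sheaf of holomorphic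
sections, which has to be locally free with respect to a local frame that is a basis of each fibre.
Equivalently, `E` has local trivialisations with holomorphic transition functions; the sheaf of
sections plays the role of the maximal atlas of these, which makes pullback strictly functorial.
The rank is finite and locally constant. -/

open CMan

/-- Let `IsHol s x` say that the section `s` is holomorphic near `x`. The sections `e 0, ..., e (r-1)`
are a local holomorphic frame near `x`: at each point `y` near `x` their values are a basis of the
fibre, and a section is holomorphic near `y` if and only if near `y` it is a combination of the `e i`
with coefficients that are holomorphic at `y`. In other words, `e` is a trivialisation
near `x` that identifies the holomorphic sections with the holomorphic maps to `ℂ^r`. -/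
def IsLocalFrame {U : CMan.{u}} {fib : U → Type u} [∀ x, AddCommGroup (fib x)]
    [∀ x, Module ℂ (fib x)] (IsHol : (∀ y, fib y) → U → Prop) {r : ℕ}
    (e : Fin r → ∀ y, fib y) (x : U) : Prop :=
  ∀ᶠ y in 𝓝 x,
    (LinearIndependent ℂ (fun i => e i y) ∧ ⊤ ≤ Submodule.span ℂ (Set.range fun i => e i y)) ∧
    ∀ s : ∀ z, fib z, IsHol s y ↔
      ∃ c : Fin r → U → ℂ, (∀ i, HolAt (c i) y) ∧ ∀ᶠ z in 𝓝 y, s z = ∑ i, c i z • e i z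

/-- A holomorphic vector bundle of finite rank on `U`: fibres, and the predicate
`IsHol s x` that a (set-theoretic) section `s` is holomorphic on a neighbourhood of `x`, such that
there is a local holomorphic frame near each point. -/
structure HolBundle (U : CMan.{u}) : Type (u + 1) where
  fib : U → Type u
  [acg : ∀ x, AddCommGroup (fib x)]
  [mod : ∀ x, Module ℂ (fib x)]
  IsHol : (∀ y, fib y) → U → Prop
  locallyFree : ∀ x, ∃ (r : ℕ) (e : Fin r → ∀ y, fib y), IsLocalFrame IsHol e x

attribute [instance] HolBundle.acg HolBundle.mod

namespace HolBundle

variable {U V W : CMan.{u}}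

/-- `e` is a local holomorphic frame of `E` near `x`. -/
abbrev IsFrame (E : HolBundle U) {r : ℕ} (e : Fin r → ∀ y, E.fib y) (x : U) : Prop :=
  IsLocalFrame E.IsHol e x

section frames
variable {E : HolBundle U} {r : ℕ} {e : Fin r → ∀ y, E.fib y} {x : U}

theorem IsFrame.eventually (h : E.IsFrame e x) : ∀ᶠ y in 𝓝 x, E.IsFrame e y :=
  eventually_eventually_nhds.2 h

theorem IsFrame.isHol_iff (h : E.IsFrame e x) (s : ∀ y, E.fib y) : E.IsHol s x ↔
    ∃ c : Fin r → U → ℂ, (∀ i, HolAt (c i) x) ∧ ∀ᶠ z in 𝓝 x, s z = ∑ i, c i z • e i z :=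
  (h.self_of_nhds).2 s

/-- The basis of the fibre given by a frame. -/
noncomputable def IsFrame.basis (h : E.IsFrame e x) : Module.Basis (Fin r) ℂ (E.fib x) :=
  Module.Basis.mk h.self_of_nhds.1.1 h.self_of_nhds.1.2

theorem IsFrame.basis_apply (h : E.IsFrame e x) (i : Fin r) : h.basis i = e i x := by
  simp [IsFrame.basis]

theorem IsFrame.coeff_unique (h : E.IsFrame e x) {c d : Fin r → U → ℂ}
    (hcd : ∀ᶠ z in 𝓝 x, ∑ i, c i z • e i z = ∑ i, d i z • e i z) (i : Fin r) :
    c i =ᶠ[𝓝 x] d i := by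
  filter_upwards [h, hcd] with z hz hz'
  have := Fintype.linearIndependent_iff.1 hz.1.1 (fun i => c i z - d i z)
    (by simp [sub_smul, hz']) i
  exact sub_eq_zero.1 this

theorem IsFrame.isHol (h : E.IsFrame e x) (i : Fin r) : E.IsHol (e i) x := by
  classical
  rw [h.isHol_iff]
  refine ⟨fun j _ => if j = i then 1 else 0, fun j => HolAt.const _ _, ?_⟩
  exact Filter.Eventually.of_forall fun z => by simp

theorem isHol_congr {s t : ∀ y, E.fib y} (hs : E.IsHol s x) (h : ∀ᶠ z in 𝓝 x, t z = s z) :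
    E.IsHol t x := by
  obtain ⟨r, e, he⟩ := E.locallyFree x
  obtain ⟨c, hc, hsc⟩ := (IsFrame.isHol_iff he s).1 hs
  refine (IsFrame.isHol_iff he t).2 ⟨c, hc, ?_⟩
  filter_upwards [hsc, h] with z h1 h2
  rw [h2, h1]

theorem isHol_sum {n : ℕ} {c : Fin n → U → ℂ} {t : Fin n → ∀ y, E.fib y}
    (hc : ∀ i, HolAt (c i) x) (ht : ∀ i, E.IsHol (t i) x) :
    E.IsHol (fun y => ∑ i, c i y • t i y) x := by
  obtain ⟨r, e, he⟩ := E.locallyFree x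
  choose a ha hta using fun i => (IsFrame.isHol_iff he (t i)).1 (ht i)
  refine (IsFrame.isHol_iff he _).2 ⟨fun j y => ∑ i, c i y * a i j y,
    fun j => HolAt.sum _ fun i => (hc i).mul (ha i j), ?_⟩
  filter_upwards [Filter.eventually_all.2 hta] with z hz
  simp only [hz, Finset.smul_sum, smul_smul, Finset.sum_smul]
  exact Finset.sum_comm

theorem isHol_add {s t : ∀ y, E.fib y} (hs : E.IsHol s x) (ht : E.IsHol t x) :
    E.IsHol (fun y => s y + t y) x := by
  have := isHol_sum (E := E) (x := x) (n := 2) (c := fun _ _ => 1) (t := ![s, t])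
    (fun _ => HolAt.const _ _) (by simp [Fin.forall_fin_two, hs, ht])
  simpa [Fin.sum_univ_two] using this

theorem isHol_smul {c : U → ℂ} {s : ∀ y, E.fib y} (hc : HolAt c x) (hs : E.IsHol s x) :
    E.IsHol (fun y => c y • s y) x := by
  have := isHol_sum (E := E) (x := x) (n := 1) (c := fun _ => c) (t := fun _ => s)
    (fun _ => hc) (fun _ => hs)
  simpa using this

end frames

/-- The holomorphic sections of `φ^* E`: those whose coefficients with respect to the pullback
of a local holomorphic frame of `E` are holomorphic. -/
def PullbackIsHol (φ : HolMap U V) (E : HolBundle V) (s : ∀ y : U, E.fib (φ y)) (x : U) : Prop :=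
  ∃ (r : ℕ) (e : Fin r → ∀ y, E.fib y) (c : Fin r → U → ℂ), E.IsFrame e (φ x) ∧
    (∀ i, HolAt (c i) x) ∧ ∀ᶠ z in 𝓝 x, s z = ∑ i, c i z • e i (φ z)

theorem tendsto_map (φ : HolMap U V) (x : U) : Filter.Tendsto φ (𝓝 x) (𝓝 (φ x)) :=
  φ.contMDiff.continuous.continuousAt

theorem pullbackIsHol_iff (φ : HolMap U V) (E : HolBundle V) {r : ℕ}
    {e : Fin r → ∀ y, E.fib y} {x : U} (he : E.IsFrame e (φ x)) (s : ∀ y : U, E.fib (φ y)) :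
    PullbackIsHol φ E s x ↔ ∃ c : Fin r → U → ℂ, (∀ i, HolAt (c i) x) ∧
      ∀ᶠ z in 𝓝 x, s z = ∑ i, c i z • e i (φ z) := by
  constructor
  · rintro ⟨n, t, c, ht, hc, hs⟩
    choose a ha hta using fun i => (he.isHol_iff (t i)).1 (ht.isHol i)
    refine ⟨fun j y => ∑ i, c i y * a i j (φ y),
      fun j => HolAt.sum _ fun i => (hc i).mul ((ha i j).comp φ), ?_⟩
    filter_upwards [hs, (tendsto_map φ x).eventually (Filter.eventually_all.2 hta)] with z h1 h2
    rw [h1]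
    simp only [h2, Finset.smul_sum, smul_smul, Finset.sum_smul]
    exact Finset.sum_comm
  · rintro ⟨c, hc, hs⟩
    exact ⟨r, e, c, he, hc, hs⟩

theorem isLocalFrame_pullback (φ : HolMap U V) (E : HolBundle V) {r : ℕ}
    {e : Fin r → ∀ y, E.fib y} {x : U} (he : E.IsFrame e (φ x)) :
    IsLocalFrame (fib := fun y => E.fib (φ y)) (PullbackIsHol φ E) (fun i y => e i (φ y)) x := by
  filter_upwards [(tendsto_map φ x).eventually he.eventually] with y hy
  exact ⟨hy.self_of_nhds.1, fun s => pullbackIsHol_iff φ E hy s⟩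

/-- The pullback bundle `φ^* E`, with fibre `E_{φ x}` at `x`. -/
noncomputable abbrev pullback (φ : HolMap U V) (E : HolBundle V) : HolBundle U where
  fib x := E.fib (φ x)
  IsHol := PullbackIsHol φ E
  locallyFree x := by
    obtain ⟨r, e, he⟩ := E.locallyFree (φ x)
    exact ⟨r, _, isLocalFrame_pullback φ E he⟩

theorem pullbackIsHol_comp (φ : HolMap U V) (E : HolBundle V) {t : ∀ y, E.fib y} {x : U}
    (ht : E.IsHol t (φ x)) : (pullback φ E).IsHol (fun y => t (φ y)) x := by
  obtain ⟨r, e, he⟩ := E.locallyFree (φ x)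
  obtain ⟨c, hc, h⟩ := (IsFrame.isHol_iff he t).1 ht
  exact ⟨r, e, fun i y => c i (φ y), he, fun i => (hc i).comp φ,
    (tendsto_map φ x).eventually h⟩

theorem pullbackIsHol_id (E : HolBundle U) :
    PullbackIsHol (ContMDiffMap.id : HolMap U U) E = E.IsHol := by
  funext s x
  obtain ⟨r, e, he⟩ := E.locallyFree x
  exact propext ((pullbackIsHol_iff (ContMDiffMap.id : HolMap U U) E he s).trans
    (IsFrame.isHol_iff he s).symm)

theorem pullbackIsHol_pullback (ψ : HolMap V W) (φ : HolMap U V) (E : HolBundle W) :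
    PullbackIsHol (ContMDiffMap.comp ψ φ) E = PullbackIsHol φ (pullback ψ E) := by
  funext s x
  obtain ⟨r, e, he⟩ := E.locallyFree (ψ (φ x))
  exact propext ((pullbackIsHol_iff (ContMDiffMap.comp ψ φ) E he s).trans
    (pullbackIsHol_iff φ (pullback ψ E) (isLocalFrame_pullback ψ E he) s).symm)

end HolBundle

/-! ## Holomorphic connections -/

/-- A holomorphic connection on `E`: a `ℂ`-linear operator from holomorphic sections of `E` to
`E`-valued holomorphic 1-forms that satisfies the Leibniz rule. Here `nabla s x v` is
`(∇_v s)(x)`; it matters only if `s` is holomorphic near `x`, and is normalised to `0` otherwise,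
so that a connection carries no superfluous data. (That `∇ s` at `x` depends only on the germ of `s`
at `x` follows from the Leibniz rule, see `nabla_congr`.) -/
structure HolConnection {U : CMan.{u}} (E : HolBundle U) : Type u where
  nabla : (∀ y, E.fib y) → ∀ x : U, U.T x →ₗ[ℂ] E.fib x
  nabla_add : ∀ {s t : ∀ y, E.fib y} {x : U}, E.IsHol s x → E.IsHol t x →
    nabla (fun y => s y + t y) x = nabla s x + nabla t x
  leibniz : ∀ {c : U → ℂ} {s : ∀ y, E.fib y} {x : U}, HolAt c x → E.IsHol s x →
    ∀ v, nabla (fun y => c y • s y) x v = dFun c x v • s x + c x • nabla s x v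
  isHol : ∀ {s : ∀ y, E.fib y} {x : U}, E.IsHol s x → ∀ v : ∀ y, U.T y, HolVF v x →
    E.IsHol (fun y => nabla s y (v y)) x
  junk : ∀ {s : ∀ y, E.fib y} {x : U}, ¬ E.IsHol s x → nabla s x = 0

namespace HolConnection

open HolBundle

variable {U V W : CMan.{u}} {E : HolBundle U} (D : HolConnection E)

theorem nabla_congr {s t : ∀ y, E.fib y} {x : U} (hs : E.IsHol s x)
    (h : ∀ᶠ z in 𝓝 x, t z = s z) : D.nabla t x = D.nabla s x := by
  classical
  have ht : E.IsHol t x := isHol_congr hs h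
  let c : U → ℂ := fun z => if t z = s z then 1 else 0
  have hc1 : c =ᶠ[𝓝 x] fun _ => 1 := by
    filter_upwards [h] with z hz
    simp [c, hz]
  have hc : HolAt c x := (HolAt.const 1 x).congr hc1
  have hcx : c x = 1 := hc1.self_of_nhds
  have hd : dFun c x = 0 := by rw [dFun_congr hc1, dFun_const]
  have key : (fun y => c y • t y) = fun y => c y • s y := by
    funext y
    by_cases hy : t y = s y
    · rw [hy]
    · simp [c, hy]
  ext v
  have h1 := D.leibniz hc ht v
  have h2 := D.leibniz hc hs v
  rw [key, h2] at h1
  simpa [hcx, hd] using h1.symm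

theorem nabla_zero (x : U) : D.nabla (fun y => (0 : E.fib y)) x = 0 := by
  have h0 : E.IsHol (fun y => (0 : E.fib y)) x := by
    have := isHol_sum (E := E) (x := x) (n := 0) (c := fun _ _ => 1) (t := fun i => i.elim0)
      (fun i => i.elim0) (fun i => i.elim0)
    simpa using this
  have := D.nabla_add h0 h0
  simpa using this

theorem nabla_sum {n : ℕ} {c : Fin n → U → ℂ} {t : Fin n → ∀ y, E.fib y} {x : U}
    (hc : ∀ i, HolAt (c i) x) (ht : ∀ i, E.IsHol (t i) x) (v : U.T x) :
    D.nabla (fun y => ∑ i, c i y • t i y) x v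
      = ∑ i, (dFun (c i) x v • t i x + c i x • D.nabla (t i) x v) := by
  induction n with
  | zero => simp [D.nabla_zero]
  | succ n ih =>
    simp only [Fin.sum_univ_succ]
    rw [D.nabla_add (isHol_smul (hc 0) (ht 0))
      (isHol_sum (fun i => hc i.succ) (fun i => ht i.succ)), LinearMap.add_apply,
      D.leibniz (hc 0) (ht 0), ih (fun i => hc i.succ) (fun i => ht i.succ)]

theorem ext_nabla {D D' : HolConnection E} (h : D.nabla = D'.nabla) : D = D' := by
  cases D; cases D'; cases h; rfl

end HolConnection

namespace CMan
variable {U V W : CMan.{u}}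

theorem HolAt.eventually {c : U → ℂ} {x : U} (hc : HolAt c x) : ∀ᶠ y in 𝓝 x, HolAt c y :=
  (contMDiffAt_iff_contMDiffAt_nhds (by simp)).1 hc

theorem HolAt.dFun_apply {c : U → ℂ} {x : U} (hc : HolAt c x) {v : ∀ y : U, U.T y}
    (hv : HolVF v x) : HolAt (fun y => dFun c y (v y)) x := by
  have : IsManifold U.I 1 U := IsManifold.of_le (n := ω) le_top
  have h1 := ContMDiffAt.mfderiv_const (m := ω) hc le_top
  have h2 : ContMDiffAt U.I (𝓘(ℂ)).tangent ω
      (fun y => (⟨c y, mfderiv U.I 𝓘(ℂ) c y (v y)⟩ : TangentBundle 𝓘(ℂ) ℂ)) x :=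
    ContMDiffAt.clm_apply_of_inCoordinates h1 hv hc
  have h3 := ((Bundle.contMDiffAt_totalSpace).1 h2).2
  have h4 : ContMDiffAt U.I 𝓘(ℂ) ω (fun y => (mfderiv U.I 𝓘(ℂ) c y (v y) : ℂ)) x := by
    simpa using h3
  exact h4

end CMan

namespace HolConnection

open HolBundle

variable {U V W : CMan.{u}}

open Classical in
/-- The operator of the pullback connection `φ^* ∇`. If `s = ∑ i, c i • φ^* (e i)` near `x`, with
`e i` holomorphic sections of `E` near `φ x` and `c i` holomorphic near `x`, then
`(φ^* ∇) s = ∑ i, dc i ⊗ φ^* (e i) + c i • φ^* (∇ (e i))`; by `pullbackNabla_eq` this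
does not depend on the choices. -/
noncomputable def pullbackNabla (φ : HolMap U V) {E : HolBundle V} (D : HolConnection E)
    (s : ∀ y : U, E.fib (φ y)) (x : U) : U.T x →ₗ[ℂ] E.fib (φ x) :=
  if h : PullbackIsHol φ E s x then
    ∑ i, ((dFun (h.choose_spec.choose_spec.choose i) x).smulRight
        (h.choose_spec.choose i (φ x)) +
      h.choose_spec.choose_spec.choose i x •
        (D.nabla (h.choose_spec.choose i) (φ x)).comp (dMap φ x))
  else 0

theorem pullbackNabla_eq (φ : HolMap U V) {E : HolBundle V} (D : HolConnection E) {x : U} {n : ℕ}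
    {c : Fin n → U → ℂ} {t : Fin n → ∀ y, E.fib y} (hc : ∀ i, HolAt (c i) x)
    (ht : ∀ i, E.IsHol (t i) (φ x)) {s : ∀ y : U, E.fib (φ y)}
    (hs : ∀ᶠ z in 𝓝 x, s z = ∑ i, c i z • t i (φ z)) (v : U.T x) :
    pullbackNabla φ D s x v = ∑ i, (dFun (c i) x v • t i (φ x) +
      c i x • D.nabla (t i) (φ x) (dMap φ x v)) := by
  have h : PullbackIsHol φ E s x :=
    isHol_congr (E := pullback φ E) (isHol_sum (E := pullback φ E) hc
      fun i => pullbackIsHol_comp φ E (ht i)) hs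
  rw [pullbackNabla, dif_pos h]
  obtain ⟨he, hd, hsd⟩ := h.choose_spec.choose_spec.choose_spec
  generalize h.choose_spec.choose_spec.choose = d at hd hsd ⊢
  generalize h.choose_spec.choose = e at he hsd ⊢
  choose a ha hta using fun i => (he.isHol_iff (t i)).1 (ht i)
  have hcoef : ∀ j, d j =ᶠ[𝓝 x] fun y => ∑ i, c i y * a i j (φ y) := by
    refine IsFrame.coeff_unique (E := pullback φ E) (isLocalFrame_pullback φ E he) ?_
    filter_upwards [hs, hsd, (tendsto_map φ x).eventually (Filter.eventually_all.2 hta)]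
      with z h1 h2 h3
    rw [← h2, h1]
    simp only [h3, Finset.smul_sum, smul_smul, Finset.sum_smul]
    exact Finset.sum_comm
  have hnab : ∀ i w, D.nabla (t i) (φ x) w
      = ∑ j, (dFun (a i j) (φ x) w • e j (φ x) + a i j (φ x) • D.nabla (e j) (φ x) w) := by
    intro i w
    rw [D.nabla_congr (isHol_sum (ha i) fun j => he.isHol j) (hta i),
      D.nabla_sum (ha i) (fun j => he.isHol j)]
  have htx : ∀ i, t i (φ x) = ∑ j, a i j (φ x) • e j (φ x) := fun i => (hta i).self_of_nhds
  simp only [LinearMap.sum_apply, LinearMap.add_apply, LinearMap.smulRight_apply,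
    LinearMap.smul_apply, LinearMap.comp_apply, hnab, htx]
  have hdd : ∀ j, dFun (d j) x v = ∑ i, (c i x * dFun (a i j) (φ x) (dMap φ x v)
      + a i j (φ x) * dFun (c i) x v) := by
    intro j
    rw [dFun_congr (hcoef j), dFun_sum _ (fun i => (hc i).mul ((ha i j).comp φ)),
      LinearMap.sum_apply]
    refine Finset.sum_congr rfl fun i _ => ?_
    rw [dFun_mul (hc i) ((ha i j).comp φ), LinearMap.add_apply, LinearMap.smul_apply,
      LinearMap.smul_apply, dFun_comp φ (ha i j)]
    rfl
  have hdx : ∀ j, d j x = ∑ i, c i x * a i j (φ x) := fun j => (hcoef j).self_of_nhds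
  simp only [hdd, hdx, Finset.smul_sum, Finset.sum_smul, ← Finset.sum_add_distrib]
  rw [Finset.sum_comm]
  refine Finset.sum_congr rfl fun i _ => Finset.sum_congr rfl fun j _ => ?_
  module

theorem pullbackNabla_comp (φ : HolMap U V) {E : HolBundle V} (D : HolConnection E) {x : U}
    {t : ∀ y, E.fib y} (ht : E.IsHol t (φ x)) (v : U.T x) :
    pullbackNabla φ D (fun y => t (φ y)) x v = D.nabla t (φ x) (dMap φ x v) := by
  rw [pullbackNabla_eq φ D (n := 1) (c := fun _ _ => 1) (t := fun _ => t)
    (fun _ => HolAt.const _ _) (fun _ => ht) (by simp)]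
  simp [dFun_const]

/-- The pullback connection `φ^* ∇` on `φ^* E`. -/
noncomputable def pullback (φ : HolMap U V) {E : HolBundle V} (D : HolConnection E) :
    HolConnection (HolBundle.pullback φ E) where
  nabla := pullbackNabla φ D
  nabla_add {s t x} hs ht := by
    obtain ⟨r, e, he⟩ := E.locallyFree (φ x)
    obtain ⟨c, hc, hsc⟩ := (pullbackIsHol_iff φ E he s).1 hs
    obtain ⟨d, hd, htd⟩ := (pullbackIsHol_iff φ E he t).1 ht
    have heh := fun i => IsFrame.isHol he i
    ext v
    rw [LinearMap.add_apply, pullbackNabla_eq φ D hc heh hsc, pullbackNabla_eq φ D hd heh htd,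
      pullbackNabla_eq φ D (c := fun i y => c i y + d i y) (fun i => (hc i).add (hd i)) heh]
    · rw [← Finset.sum_add_distrib]
      refine Finset.sum_congr rfl fun i _ => ?_
      rw [dFun_add (hc i) (hd i), LinearMap.add_apply]
      module
    · filter_upwards [hsc, htd] with z h1 h2
      rw [h1, h2, ← Finset.sum_add_distrib]
      simp only [add_smul]
  leibniz {f s x} hf hs v := by
    obtain ⟨r, e, he⟩ := E.locallyFree (φ x)
    obtain ⟨c, hc, hsc⟩ := (pullbackIsHol_iff φ E he s).1 hs
    have heh := fun i => IsFrame.isHol he i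
    rw [pullbackNabla_eq φ D hc heh hsc,
      pullbackNabla_eq φ D (c := fun i y => f y * c i y) (fun i => hf.mul (hc i)) heh]
    · rw [hsc.self_of_nhds, Finset.smul_sum, Finset.smul_sum, ← Finset.sum_add_distrib]
      refine Finset.sum_congr rfl fun i _ => ?_
      rw [dFun_mul hf (hc i), LinearMap.add_apply, LinearMap.smul_apply, LinearMap.smul_apply]
      simp only [smul_eq_mul]
      module
    · filter_upwards [hsc] with z h1
      rw [h1, Finset.smul_sum]
      simp only [smul_smul]
  isHol {s x} hs v hv := by
    obtain ⟨r, e, he⟩ := E.locallyFree (φ x)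
    obtain ⟨c, hc, hsc⟩ := (pullbackIsHol_iff φ E he s).1 hs
    obtain ⟨b, g, hb, hg, hbg⟩ := HolVF.exists_coeff φ hv
    have key : ∀ᶠ y in 𝓝 x, pullbackNabla φ D s y (v y) =
        ∑ i, dFun (c i) y (v y) • e i (φ y) +
        ∑ i, c i y • ∑ j, g j y • D.nabla (e i) (φ y) (b j (φ y)) := by
      filter_upwards [eventually_eventually_nhds.2 hsc, hbg,
        Filter.eventually_all.2 fun i => (hc i).eventually,
        (tendsto_map φ x).eventually (IsFrame.eventually he)] with y h1 h2 h3 h4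
      rw [pullbackNabla_eq φ D h3 (fun i => h4.isHol i) h1, ← Finset.sum_add_distrib]
      refine Finset.sum_congr rfl fun i _ => ?_
      rw [h2, map_sum]
      simp only [map_smul]
    refine isHol_congr (E := HolBundle.pullback φ E) ?_ key
    refine isHol_add (E := HolBundle.pullback φ E) ?_ ?_
    · exact isHol_sum (E := HolBundle.pullback φ E) (fun i => (hc i).dFun_apply hv)
        fun i => pullbackIsHol_comp φ E (IsFrame.isHol he i)
    · refine isHol_sum (E := HolBundle.pullback φ E) hc fun i => ?_
      exact isHol_sum (E := HolBundle.pullback φ E) hg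
        fun j => pullbackIsHol_comp φ E (D.isHol (IsFrame.isHol he i) (b j) (hb j))
  junk {s x} hs := dif_neg hs

theorem pullbackNabla_id {E : HolBundle U} (D : HolConnection E) :
    pullbackNabla (ContMDiffMap.id : HolMap U U) D = D.nabla := by
  funext s x
  by_cases hs : E.IsHol s x
  · ext v
    refine (pullbackNabla_comp (ContMDiffMap.id : HolMap U U) D (x := x) hs v).trans ?_
    rw [dMap_id]
    rfl
  · rw [D.junk hs]
    exact dif_neg (by rwa [pullbackIsHol_id])

theorem pullbackNabla_pullback (ψ : HolMap V W) (φ : HolMap U V) {E : HolBundle W}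
    (D : HolConnection E) :
    pullbackNabla (ContMDiffMap.comp ψ φ) D = pullbackNabla φ (pullback ψ D) := by
  funext s x
  by_cases hs : PullbackIsHol (ContMDiffMap.comp ψ φ) E s x
  · obtain ⟨r, e, he⟩ := E.locallyFree (ψ (φ x))
    obtain ⟨c, hc, hsc⟩ := (pullbackIsHol_iff (ContMDiffMap.comp ψ φ) E he s).1 hs
    have heh := fun i => IsFrame.isHol he i
    ext v
    refine (pullbackNabla_eq (ContMDiffMap.comp ψ φ) D hc heh hsc v).trans ?_
    refine Eq.trans ?_ (pullbackNabla_eq φ (pullback ψ D) hc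
      (fun i => pullbackIsHol_comp ψ E (heh i)) hsc v).symm
    refine Finset.sum_congr rfl fun i _ => ?_
    refine congrArg₂ (· + ·) rfl (congrArg₂ (· • ·) rfl ?_)
    rw [dMap_comp]
    exact (pullbackNabla_comp ψ D (heh i) _).symm
  · refine Eq.trans (dif_neg hs) ?_
    rw [pullbackIsHol_pullback] at hs
    exact ((pullback φ (pullback ψ D)).junk hs).symm

end HolConnection

/-! ## The groupoid of bundles with connection, and its nerve -/

/-- Holomorphic vector bundles on `U` with a holomorphic connection. -/
structure HVBObj (U : CMan.{u}) : Type (u + 1) where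
  bundle : HolBundle U
  conn : HolConnection bundle

/-- Isomorphisms of holomorphic vector bundles (over the identity of `U`). -/
@[ext]
structure BundleIso {U : CMan.{u}} (E F : HolBundle U) : Type u where
  toEquiv : ∀ x, E.fib x ≃ₗ[ℂ] F.fib x
  isHol_iff : ∀ (s : ∀ y, E.fib y) (x : U),
    F.IsHol (fun y => toEquiv y (s y)) x ↔ E.IsHol s x

namespace HVBObj

variable {U V W : CMan.{u}}

/-- The groupoid of holomorphic vector bundles with holomorphic connection. The morphisms are the
isomorphisms of holomorphic bundles, which need not respect the connections. -/
instance : Groupoid.{u} (HVBObj U) where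
  Hom E F := BundleIso E.bundle F.bundle
  id E := ⟨fun _ => LinearEquiv.refl ℂ _, fun _ _ => Iff.rfl⟩
  comp f g := ⟨fun x => (f.toEquiv x).trans (g.toEquiv x),
    fun s x => (g.isHol_iff _ x).trans (f.isHol_iff s x)⟩
  inv f := ⟨fun x => (f.toEquiv x).symm, fun s x => by
    rw [← f.isHol_iff]
    simp⟩
  inv_comp f := by
    apply BundleIso.ext
    funext x
    exact LinearEquiv.symm_trans_self (f.toEquiv x)
  comp_inv f := by
    apply BundleIso.ext
    funext x
    exact LinearEquiv.self_trans_symm (f.toEquiv x)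

/-- The linear isomorphism on the fibre at `x`. -/
abbrev fibIso {E F : HVBObj U} (f : E ⟶ F) (x : U) : E.bundle.fib x ≃ₗ[ℂ] F.bundle.fib x :=
  BundleIso.toEquiv f x

theorem isHol_fibIso {E F : HVBObj U} (f : E ⟶ F) {s : ∀ y, E.bundle.fib y} {x : U}
    (hs : E.bundle.IsHol s x) : F.bundle.IsHol (fun y => fibIso f y (s y)) x :=
  (BundleIso.isHol_iff f s x).2 hs

/-- The functor that pulls back bundles with connection along a holomorphic map. -/
noncomputable def pullback (φ : HolMap U V) : HVBObj V ⥤ HVBObj U where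
  obj E := ⟨E.bundle.pullback φ, E.conn.pullback φ⟩
  map {E F} f :=
    { toEquiv := fun x => fibIso f (φ x)
      isHol_iff := fun s x => by
        obtain ⟨r, e, he⟩ := E.bundle.locallyFree (φ x)
        have hfe : F.bundle.IsFrame (fun i y => fibIso f y (e i y)) (φ x) := by
          filter_upwards [he] with y hy
          refine ⟨⟨?_, ?_⟩, fun t => ?_⟩
          · exact hy.1.1.map' (fibIso f y).toLinearMap (LinearEquiv.ker _)
          · have h1 := congrArg (Submodule.map (fibIso f y).toLinearMap) (top_le_iff.1 hy.1.2)
            rw [Submodule.map_span, Submodule.map_top, LinearEquiv.range, ← Set.range_comp] at h1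
            exact h1.ge
          · have h2 := BundleIso.isHol_iff f (fun z => (fibIso f z).symm (t z)) y
            simp only [LinearEquiv.apply_symm_apply] at h2
            rw [h2, hy.2]
            refine exists_congr fun c => and_congr_right fun _ =>
              Filter.eventually_congr (Filter.Eventually.of_forall fun z => ?_)
            rw [LinearEquiv.symm_apply_eq]
            simp
        refine (HolBundle.pullbackIsHol_iff φ F.bundle hfe _).trans
          (Iff.trans ?_ (HolBundle.pullbackIsHol_iff φ E.bundle he s).symm)
        refine exists_congr fun c => and_congr_right fun _ =>
          Filter.eventually_congr (Filter.Eventually.of_forall fun z => ?_)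
        rw [← (fibIso f (φ z)).injective.eq_iff]
        simp }

/-- Two bundles with connection with the same fibres, sections and operator are equal. -/
theorem ext_of {fib : U → Type u} [∀ x, AddCommGroup (fib x)] [∀ x, Module ℂ (fib x)]
    {P P' : (∀ y, fib y) → U → Prop} {h h'} (hP : P = P')
    {D : HolConnection (⟨fib, P, h⟩ : HolBundle U)}
    {D' : HolConnection (⟨fib, P', h'⟩ : HolBundle U)} (hD : D.nabla = D'.nabla) :
    (⟨⟨fib, P, h⟩, D⟩ : HVBObj U) = ⟨⟨fib, P', h'⟩, D'⟩ := by
  subst hP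
  rw [HolConnection.ext_nabla hD]

theorem hom_heq {E E' F F' : HVBObj U} (hE : E = E') (hF : F = F') {f : E ⟶ F} {f' : E' ⟶ F'}
    (h : HEq (BundleIso.toEquiv f) (BundleIso.toEquiv f')) : HEq f f' := by
  subst hE hF
  exact heq_of_eq (BundleIso.ext (eq_of_heq h))

theorem pullback_id : pullback (ContMDiffMap.id : HolMap U U) = 𝟭 (HVBObj U) := by
  have h : ∀ E : HVBObj U, (pullback (ContMDiffMap.id : HolMap U U)).obj E = E := fun E =>
    ext_of (HolBundle.pullbackIsHol_id E.bundle) (HolConnection.pullbackNabla_id E.conn)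
  exact CategoryTheory.Functor.hext h fun E F f => hom_heq (h E) (h F) HEq.rfl

theorem pullback_comp (ψ : HolMap V W) (φ : HolMap U V) :
    pullback (ContMDiffMap.comp ψ φ) = pullback ψ ⋙ pullback φ := by
  have h : ∀ E : HVBObj W, (pullback (ContMDiffMap.comp ψ φ)).obj E
      = (pullback ψ ⋙ pullback φ).obj E := fun E =>
    ext_of (HolBundle.pullbackIsHol_pullback ψ φ E.bundle)
      (HolConnection.pullbackNabla_pullback ψ φ E.conn)
  exact CategoryTheory.Functor.hext h fun E F f => hom_heq (h E) (h F) HEq.rfl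

end HVBObj

/-- The presheaf of groupoids `U ↦ HVB^∇(U)`. -/
noncomputable def HVBNabla : CMan.{u}ᵒᵖ ⥤ Cat.{u, u + 1} where
  obj U := Cat.of (HVBObj U.unop)
  map φ := (HVBObj.pullback φ.unop).toCatHom
  map_id U := by
    apply Cat.ext
    exact HVBObj.pullback_id
  map_comp φ ψ := by
    apply Cat.ext
    exact HVBObj.pullback_comp φ.unop ψ.unop

/-- The (large) simplicial presheaf `HVB`, the nerve of `HVB^∇`. -/
noncomputable def HVB : CMan.{u}ᵒᵖ ⥤ SSet.{u + 1} := HVBNabla ⋙ nerveFunctor.{u, u + 1}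

/-! ## Holomorphic forms and the simplicial presheaf `Ω` -/

/-- The abelian group of holomorphic `p`-forms on `U`: families of alternating `p`-linear forms on
the tangent spaces that take holomorphic vector fields to holomorphic functions (locally). -/
def HolForm (U : CMan.{u}) (p : ℕ) : AddSubgroup (∀ x : U, (U.T x) [⋀^Fin p]→ₗ[ℂ] ℂ) where
  carrier := {η | ∀ (x : U) (v : Fin p → ∀ y : U, U.T y), (∀ i, HolVF (v i) x) →
    HolAt (fun y => η y (fun i => v i y)) x}
  zero_mem' := fun x _ _ => HolAt.const 0 x
  add_mem' := fun ha hb x v hv => (ha x v hv).add (hb x v hv)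
  neg_mem' := fun {a} ha x v hv => by
    have := (HolAt.const (-1) x).mul (ha x v hv)
    simpa using this

namespace HolForm

variable {U V W : CMan.{u}}

/-- Pullback of holomorphic forms along a holomorphic map. -/
noncomputable def pullback (φ : HolMap U V) (p : ℕ) : HolForm V p →+ HolForm U p where
  toFun η := ⟨fun x => (η.1 (φ x)).compLinearMap (dMap φ x), fun x v hv => by
    choose b c hb hc hbc using fun i => HolVF.exists_coeff φ (hv i)
    have key : ∀ᶠ y in 𝓝 x, ((η.1 (φ y)).compLinearMap (dMap φ y)) (fun i => v i y) =
        ∑ r : Fin p → Fin V.dim, (∏ i, c i (r i) y) *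
          η.1 (φ y) (fun i => b i (r i) (φ y)) := by
      filter_upwards [Filter.eventually_all.2 hbc] with y hy
      rw [AlternatingMap.compLinearMap_apply]
      have h1 : (fun i => dMap φ y (v i y)) = fun i => ∑ j, c i j y • b i j (φ y) := funext hy
      have h2 := (η.1 (φ y)).toMultilinearMap.map_sum fun i j => c i j y • b i j (φ y)
      simp only [MultilinearMap.map_smul_univ] at h2
      rw [h1]
      exact h2
    refine HolAt.congr ?_ key
    exact HolAt.sum _ fun r => (HolAt.prod _ fun i => hc i (r i)).mul
      ((η.2 (φ x) (fun i => b i (r i)) fun i => hb i (r i)).comp φ)⟩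
  map_zero' := rfl
  map_add' _ _ := rfl

end HolForm

/-- The presheaf of non-negatively graded cochain complexes `U ↦ (Ω_hol^•(U), d = 0)`. -/
noncomputable def OmegaHol : CMan.{u}ᵒᵖ ⥤ CochainComplex AddCommGrpCat.{u} ℕ where
  obj U :=
    { X := fun p => AddCommGrpCat.of (HolForm U.unop p)
      d := fun _ _ => 0 }
  map φ := { f := fun p => AddCommGrpCat.ofHom (HolForm.pullback φ.unop p) }
  map_id U := by
    ext p η x v
    refine DFunLike.congr_fun ?_ v
    change (η.1 x).compLinearMap (dMap (ContMDiffMap.id : HolMap U.unop U.unop) x) = η.1 x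
    rw [dMap_id, AlternatingMap.compLinearMap_id]
  map_comp φ ψ := by
    ext p η x v
    change η.1 _ (fun i => dMap (ContMDiffMap.comp φ.unop ψ.unop) x (v i)) =
      η.1 _ (fun i => dMap φ.unop _ (dMap ψ.unop x (v i)))
    simp only [dMap_comp]
    rfl

/-- The pairs `(j, p)` such that `C^j u^p` has cohomological degree `j - 2 p = -m`. -/
abbrev QIndex (m : ℕ) : Type := {a : ℕ × ℕ // a.1 + m = 2 * a.2}

/-- The functor `Q` from non-negatively to non-positively graded cochain complexes (the latter
are written as chain complexes, so that cohomological degree `-m` is chain degree `m`):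
`Q(C) = C[u]^{• ≤ 0}` is the quotient of `C ⊗ ℤ[u]`, where `u` has degree `-2` and `du = 0`, by the
components of positive degree. In degree `-m` it is the direct sum of the `C^j u^p`
over all `j, p ≥ 0` with `j - 2 p = -m`. -/
noncomputable def QFunctor :
    CochainComplex AddCommGrpCat.{u} ℕ ⥤ ChainComplex AddCommGrpCat.{u} ℕ where
  obj C := ChainComplex.of
    (fun m => AddCommGrpCat.of (DirectSum (QIndex m) fun a => C.X a.1.1))
    (fun m => AddCommGrpCat.ofHom (DirectSum.toAddMonoid fun a =>
      (DirectSum.of (fun b : QIndex m => C.X b.1.1)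
        ⟨(a.1.1 + 1, a.1.2), by have := a.2; lia⟩).comp (C.d a.1.1 (a.1.1 + 1)).hom))
    (fun m => by
      ext a x
      have h : (C.d (a.1.1 + 1) (a.1.1 + 1 + 1)).hom ((C.d a.1.1 (a.1.1 + 1)).hom x) = 0 :=
        ConcreteCategory.congr_hom (C.d_comp_d a.1.1 (a.1.1 + 1) (a.1.1 + 1 + 1)) x
      simp [h])
  map {C D} f := ChainComplex.ofHom
    (fun m => AddCommGrpCat.ofHom (DirectSum.map fun a : QIndex m => (f.f a.1.1).hom))
    (fun m => by
      ext a x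
      have h : (D.d a.1.1 (a.1.1 + 1)).hom ((f.f a.1.1).hom x) =
          (f.f (a.1.1 + 1)).hom ((C.d a.1.1 (a.1.1 + 1)).hom x) :=
        ConcreteCategory.congr_hom (f.comm a.1.1 (a.1.1 + 1)) x
      simp [h])
  map_id C := by
    ext m x
    simp
  map_comp f g := by
    ext m x
    simp

/-- The cosimplicial chain complex `[k] ↦ N(ℤΔ^k)` of normalized chains of the standard simplices. -/
noncomputable def NZDelta : SimplexCategory ⥤ ChainComplex AddCommGrpCat.{u} ℕ :=
  SSet.stdSimplex.{u} ⋙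
    SSet.normalizedChainComplexFunctorObj (AddCommGrpCat.of (ULift.{u} ℤ))

/-- The Dold-Kan functor: `DK(C)` is the simplicial abelian group whose `k`-simplices are the
chain maps `N(ℤΔ^k) → C`. -/
noncomputable def DKFunctor :
    ChainComplex AddCommGrpCat.{u} ℕ ⥤ SimplicialObject AddCommGrpCat.{u} :=
  preadditiveYoneda ⋙ (Functor.whiskeringLeft _ _ _).obj NZDelta.{u}.op

/-- The simplicial set underlying `DK(C)`. -/
noncomputable def DKUnderlying : ChainComplex AddCommGrpCat.{u} ℕ ⥤ SSet.{u} :=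
  DKFunctor ⋙ (SimplicialObject.whiskering _ _).obj (forget AddCommGrpCat.{u})

/-- The simplicial presheaf `Ω`: the composite of `U ↦ (Ω_hol^•(U), 0)`, the functor `Q`, the
Dold-Kan functor and the forgetful functor, regarded as taking values in large simplicial sets. -/
noncomputable def Omega : CMan.{u}ᵒᵖ ⥤ SSet.{u + 1} :=
  OmegaHol ⋙ QFunctor ⋙ DKUnderlying ⋙ SSet.uliftFunctor.{u + 1, u}

/-- The generator `e_{i_0, ..., i_ℓ}` of `N(ℤΔ^k)` in degree `ℓ`, for `i_0 < ... < i_ℓ`. -/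
noncomputable def cellGen {k ℓ : ℕ} (i : Fin (ℓ + 1) ↪o Fin (k + 1)) :
    (NZDelta.{u}.obj (SimplexCategory.mk k)).X ℓ :=
  (SSet.ιNormalizedChainComplex (R := AddCommGrpCat.of (ULift.{u} ℤ))
    (SSet.stdSimplex.{u}.obj (SimplexCategory.mk k))
    (SSet.stdSimplex.objEquiv.symm (SimplexCategory.Hom.mk i.toOrderHom))).hom (ULift.up 1)

/-- A `k`-simplex of `Ω(U)`, as a chain map `N(ℤΔ^k) → Ω_hol^•(U)[u]^{• ≤ 0}`. -/
def Omega.toChainMap {U : CMan.{u}} {k : ℕ}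
    (σ : (Omega.obj (op U)).obj (op (SimplexCategory.mk k))) :
    NZDelta.{u}.obj (SimplexCategory.mk k) ⟶ QFunctor.obj (OmegaHol.obj (op U)) :=
  σ.down

/-- The element `η · u^ℓ` of degree `-ℓ`, for a holomorphic `ℓ`-form `η`. -/
noncomputable def formMulUPow {U : CMan.{u}} {ℓ : ℕ} (η : HolForm U ℓ) :
    (QFunctor.obj (OmegaHol.obj (op U))).X ℓ :=
  DirectSum.of (fun a : QIndex ℓ => HolForm U a.1.1) ⟨(ℓ, ℓ), by lia⟩ η

/-! ## The trace forms -/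

namespace HVBObj
variable {U : CMan.{u}}

/-- The connections on `E` and `F` induce a connection on `Hom(E, F)`, and `∇ f` is the unique
`Hom(E, F)`-valued 1-form with `(∇_v f)(s) = ∇_v (f s) - f (∇_v s)` for all holomorphic local
sections `s` of `E`. -/
theorem existsUnique_nablaHom {E F : HVBObj U} (f : E ⟶ F) (x : U) :
    ∃! A : U.T x →ₗ[ℂ] E.bundle.fib x →ₗ[ℂ] F.bundle.fib x,
      ∀ s : ∀ y, E.bundle.fib y, E.bundle.IsHol s x → ∀ v : U.T x,
        A v (s x) = F.conn.nabla (fun y => fibIso f y (s y)) x v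
          - fibIso f x (E.conn.nabla s x v) := by
  obtain ⟨r, e, he⟩ := E.bundle.locallyFree x
  replace he : E.bundle.IsFrame e x := he
  let g : Fin r → U.T x →ₗ[ℂ] F.bundle.fib x := fun i =>
    F.conn.nabla (fun y => fibIso f y (e i y)) x -
      (fibIso f x).toLinearMap ∘ₗ E.conn.nabla (e i) x
  refine ⟨LinearMap.mk₂ ℂ (fun v a => ∑ i, he.basis.repr a i • g i v) ?_ ?_ ?_ ?_, ?_, ?_⟩
  · intro v w a
    simp [Finset.sum_add_distrib]
  · intro c v a
    simp only [map_smul, Finset.smul_sum]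
    exact Finset.sum_congr rfl fun i _ => smul_comm _ _ _
  · intro v a b
    simp [Finset.sum_add_distrib, add_smul]
  · intro c v a
    simp [Finset.smul_sum, smul_smul]
  · intro s hs v
    obtain ⟨c, hc, hsc⟩ := (he.isHol_iff s).1 hs
    have h1 : ∀ i, he.basis.repr (s x) i = c i x := by
      intro i
      rw [hsc.self_of_nhds]
      simp only [← he.basis_apply]
      rw [he.basis.repr_sum_self]
    have h2 : ∀ᶠ z in 𝓝 x, fibIso f z (s z) = ∑ i, c i z • fibIso f z (e i z) := by
      filter_upwards [hsc] with z hz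
      rw [hz]
      simp
    have hfe := fun i => isHol_fibIso f (he.isHol i)
    rw [F.conn.nabla_congr (HolBundle.isHol_sum hc hfe) h2, F.conn.nabla_sum hc hfe,
      E.conn.nabla_congr (HolBundle.isHol_sum hc fun i => he.isHol i) hsc,
      E.conn.nabla_sum hc fun i => he.isHol i, LinearMap.mk₂_apply]
    simp only [h1, map_sum, map_add, map_smul, ← Finset.sum_sub_distrib]
    refine Finset.sum_congr rfl fun i _ => ?_
    simp only [g, LinearMap.sub_apply, LinearMap.comp_apply, LinearEquiv.coe_coe]
    module
  · intro A hA
    refine LinearMap.ext fun v => he.basis.ext fun i => ?_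
    rw [LinearMap.mk₂_apply, he.basis_apply, hA (e i) (he.isHol i)]
    simp [← he.basis_apply, g, Finsupp.single_apply]

/-- The value at `x` of the `Hom(E, F)`-valued 1-form `∇ f`, where `∇` is the connection on
`Hom(E, F)` that is induced by the connections of `E` and `F`. -/
noncomputable def nablaHom {E F : HVBObj U} (f : E ⟶ F) (x : U) :
    U.T x →ₗ[ℂ] E.bundle.fib x →ₗ[ℂ] F.bundle.fib x :=
  (existsUnique_nablaHom f x).choose

/-- The composite `A (ℓ-1) ∘ ... ∘ A 1 ∘ A 0` of linear maps `A j : V j → V (j+1)`. -/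
def compChain : (ℓ : ℕ) → (V : Fin (ℓ + 1) → Type u) → [∀ j, AddCommGroup (V j)] →
    [∀ j, Module ℂ (V j)] → (∀ j : Fin ℓ, V j.castSucc →ₗ[ℂ] V j.succ) →
    (V 0 →ₗ[ℂ] V (Fin.last ℓ))
  | 0, _, _, _, _ => LinearMap.id
  | ℓ + 1, V, _, _, A =>
    A (Fin.last ℓ) ∘ₗ compChain ℓ (fun j : Fin (ℓ + 1) => V j.castSucc) fun j => A j.castSucc

/-- The composite `f̃_{q,p} : E_p → E_q` in a chain `E_0 → E_1 → ... → E_k`, for `p ≤ q`. -/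
abbrev tilde {k : ℕ} (E : ComposableArrows (HVBObj U) k) {p q : Fin (k + 1)} (h : p ≤ q) :
    E.obj p ⟶ E.obj q :=
  E.map (homOfLE h)

/-- The value at `x`, on tangent vectors `w 0, ..., w (ℓ-1)`, of the coefficient of `u^ℓ` assigned
to `e_{i_0, ..., i_ℓ}`. For `ℓ = 0` it is the dimension of the fibre of `E_{i_0}`. For `ℓ > 0` it is
the `ℓ`-form
`tr (f̃_{i_ℓ,i_0}⁻¹ ∘ ∇ f̃_{i_ℓ,i_{ℓ-1}} ∘ ... ∘ ∇ f̃_{i_2,i_1} ∘ ∇ f̃_{i_1,i_0})`, where the product of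
`Hom`-valued 1-forms is the wedge product combined with composition: the alternating sum over all
distributions of the `w j` to the factors, in which the leftmost factor takes the first argument. -/
noncomputable def chCoeff {k : ℕ} (E : ComposableArrows (HVBObj U) k) : (ℓ : ℕ) →
    (Fin (ℓ + 1) ↪o Fin (k + 1)) → (x : U) → (Fin ℓ → U.T x) → ℂ
  | 0, i, x, _ => (Module.finrank ℂ ((E.obj (i 0)).bundle.fib x) : ℂ)
  | ℓ + 1, i, x, w =>
    ∑ σ : Equiv.Perm (Fin (ℓ + 1)), ((Equiv.Perm.sign σ : ℤ) : ℂ) *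
      LinearMap.trace ℂ ((E.obj (i 0)).bundle.fib x)
        ((fibIso (tilde E (i.monotone (Fin.zero_le (Fin.last (ℓ + 1))))) x).symm.toLinearMap ∘ₗ
          compChain (ℓ + 1) (fun j => (E.obj (i j)).bundle.fib x) fun j =>
            nablaHom (tilde E (i.monotone (Fin.castSucc_lt_succ (i := j)).le)) x (w (σ j.rev)))

end HVBObj

/-!
The value of `Ch` on a chain `E_0 → ⋯ → E_k` only involves, fibrewise, one vector space and a family
of endomorphism-valued 1-forms on it. Choose a bundle `B` with isomorphisms `g_q : B → E_q` that are
compatible with the maps of the chain (for instance `B = E_0`, `g_q = f̃_{q,0}`), and let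
`c_q = g_q⁻¹ ∘ ∇ g_q`, the difference between the connection of `E_q`, transported to `B`, and the
connection of `B`. The Leibniz rule `∇ (f ∘ g) = ∇ f ∘ g + f ∘ ∇ g` gives
`f̃_{q,0}⁻¹ ∘ ∇ f̃_{q,p} ∘ f̃_{p,0} = c_q - c_p` (`connForm_comp`, for `B = E_0`), so the trace form of
the statement is the alternating sum of the traces of the products
`(c_ℓ - c_{ℓ-1}) (c_{ℓ-1} - c_{ℓ-2}) ⋯ (c_1 - c_0)` (`chCoeff_eq_traceForm`). Invariance of the trace
under conjugation makes this hold for every choice of `B` and `g`.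

The independence of the base `B` reduces simplicial compatibility to algebra in a ring. The
differential of the target vanishes, so being a chain map means that the alternating sum over the
faces vanishes. All faces of a chain can be computed with the same base, where they delete one of
the `c_q`, and already the products have vanishing alternating sum: this is an induction that splits
off the leftmost factor (`sum_stepProd_succAbove`). A degenerate chain has two equal neighbours
`c_j = c_{j+1}`, so one factor is zero (`stepProd_eq_zero`).

The trace forms are holomorphic because `∇ f` along a holomorphic vector field takes holomorphic
sections to holomorphic sections, and the trace of an endomorphism with this property is
holomorphic by a computation in a local frame (`holAt_traceForm`). They commute with pullback because
`∇ (φ^* f) = φ^* (∇ f)` (`nablaHom_pullback`), by the uniqueness of `∇ f`.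

Since the form `chForm` is defined for each chain of length `ℓ`, and a cell of `Δ^k` acts on chains by
restriction, the construction is natural in `[k]` by design. Both existence and uniqueness
then follow from the fact that the normalized chains of `Δ^k` are free on its nondegenerate
simplices.
-/

/-! ### Alternating sums of products of differences -/

section StepProd
variable {T A : Type*} [Ring A]

/-- The product `(c ℓ - c (ℓ-1)) (w 0) * ⋯ * (c 1 - c 0) (w (ℓ-1))` of the successive differences of
a family of ring-valued functions, with the leftmost factor evaluated at the first argument. -/
def stepProd {ℓ : ℕ} (c : Fin (ℓ + 1) → T → A) (w : Fin ℓ → T) : A :=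
  (List.ofFn fun m : Fin ℓ => c m.rev.succ (w m) - c m.rev.castSucc (w m)).prod

theorem stepProd_zero (c : Fin 1 → T → A) (w : Fin 0 → T) : stepProd c w = 1 := by
  simp [stepProd]

theorem stepProd_succ {ℓ : ℕ} (c : Fin (ℓ + 2) → T → A) (w : Fin (ℓ + 1) → T) :
    stepProd c w = (c (Fin.last (ℓ + 1)) (w 0) - c (Fin.last ℓ).castSucc (w 0)) *
      stepProd (fun q => c q.castSucc) (fun m => w m.succ) := by
  simp only [stepProd, List.ofFn_succ, Fin.rev_succ, List.prod_cons, Fin.rev_zero, Fin.succ_last,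
    Fin.castSucc_succ]

theorem stepProd_eq_zero {ℓ : ℕ} (c : Fin (ℓ + 1) → T → A) (w : Fin ℓ → T) (j : Fin ℓ)
    (h : c j.castSucc = c j.succ) : stepProd c w = 0 := by
  induction ℓ with
  | zero => exact j.elim0
  | succ ℓ ih =>
    rw [stepProd_succ]
    cases j using Fin.lastCases with
    | last => rw [h, Fin.succ_last, sub_self, zero_mul]
    | cast j => rw [ih (fun q => c q.castSucc) _ j h, mul_zero]

/-- The alternating sum over all ways to delete one member of the family `c` vanishes. By
induction: for a family with top index `ℓ + 2`, the faces that keep the two topmost members share the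
leftmost factor `c (ℓ+2) - c (ℓ+1)`, and the remaining two faces combine to a multiple of the same
factor, since `(c (ℓ+2) - c ℓ) - (c (ℓ+1) - c ℓ) = c (ℓ+2) - c (ℓ+1)`. This leaves the identity for
the family without its topmost member. -/
theorem sum_stepProd_succAbove {ℓ : ℕ} (c : Fin (ℓ + 2) → T → A) (w : Fin ℓ → T) :
    ∑ j : Fin (ℓ + 2), (-1 : ℤ) ^ (j : ℕ) • stepProd (fun q => c (j.succAbove q)) w = 0 := by
  induction ℓ with
  | zero => simp [Fin.sum_univ_two, stepProd_zero]
  | succ ℓ ih =>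
    have top : ∀ j : Fin (ℓ + 2), j.castSucc.succAbove (Fin.last (ℓ + 1)) = Fin.last (ℓ + 2) := by
      intro j
      rw [Fin.succAbove_of_le_castSucc _ _ (Fin.castSucc_le_castSucc_iff.2 j.le_last),
        Fin.succ_last]
    have next : ∀ j : Fin (ℓ + 1), j.castSucc.castSucc.succAbove (Fin.last ℓ).castSucc =
        (Fin.last (ℓ + 1)).castSucc := by
      intro j
      rw [Fin.succAbove_of_le_castSucc _ _ (by simpa [Fin.le_def] using Nat.lt_succ_iff.1 j.2)]
      rfl
    have h1 : ∀ j : Fin (ℓ + 1), stepProd (fun q => c (j.castSucc.castSucc.succAbove q)) w =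
        (c (Fin.last (ℓ + 2)) (w 0) - c (Fin.last (ℓ + 1)).castSucc (w 0)) *
          stepProd (fun q => c (j.castSucc.succAbove q).castSucc) (fun m => w m.succ) := by
      intro j
      rw [stepProd_succ, top, next]
      simp only [Fin.castSucc_succAbove_castSucc]
    have h2 : stepProd (fun q => c ((Fin.last (ℓ + 1)).castSucc.succAbove q)) w =
        (c (Fin.last (ℓ + 2)) (w 0) - c (Fin.last ℓ).castSucc.castSucc (w 0)) *
          stepProd (fun q => c ((Fin.last (ℓ + 1)).succAbove q).castSucc) (fun m => w m.succ) := by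
      rw [stepProd_succ, top]
      simp only [Fin.castSucc_succAbove_castSucc, Fin.succAbove_last]
    have h3 : stepProd (fun q => c ((Fin.last (ℓ + 2)).succAbove q)) w =
        (c (Fin.last (ℓ + 1)).castSucc (w 0) - c (Fin.last ℓ).castSucc.castSucc (w 0)) *
          stepProd (fun q => c ((Fin.last (ℓ + 1)).succAbove q).castSucc) (fun m => w m.succ) := by
      rw [stepProd_succ]
      simp only [Fin.succAbove_last]
    have h4 := ih (fun q => c q.castSucc) (fun m => w m.succ)
    rw [Fin.sum_univ_castSucc] at h4 ⊢
    rw [Fin.sum_univ_castSucc, h2, h3]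
    simp only [h1, ← mul_smul_comm, ← Finset.mul_sum, Fin.val_castSucc, Fin.val_last] at h4 ⊢
    rw [eq_neg_of_add_eq_zero_left h4]
    simp only [pow_succ, mul_neg, mul_smul_comm, mul_one, neg_smul, neg_neg, sub_mul, smul_sub]
    abel
end StepProd

/-! ### Trace forms of families of endomorphism-valued 1-forms -/

section TraceForm
variable {T : Type*} [AddCommGroup T] [Module ℂ T] {V : Type*} [AddCommGroup V] [Module ℂ V]

/-- The alternating form
`w ↦ ∑ σ, sgn σ * tr ((c ℓ - c (ℓ-1)) (w (σ 0)) ∘ ⋯ ∘ (c 1 - c 0) (w (σ (ℓ-1))))` of a family of endomorphism-valued linear forms `c`. -/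
noncomputable def traceForm {ℓ : ℕ} (c : Fin (ℓ + 1) → T →ₗ[ℂ] Module.End ℂ V) :
    T [⋀^Fin ℓ]→ₗ[ℂ] ℂ :=
  MultilinearMap.alternatization ((LinearMap.trace ℂ V).compMultilinearMap
    ((MultilinearMap.mkPiAlgebraFin ℂ ℓ (Module.End ℂ V)).compLinearMap
      fun m => c m.rev.succ - c m.rev.castSucc))

theorem traceForm_apply {ℓ : ℕ} (c : Fin (ℓ + 1) → T →ₗ[ℂ] Module.End ℂ V) (w : Fin ℓ → T) :
    traceForm c w = ∑ σ : Equiv.Perm (Fin ℓ), ((Equiv.Perm.sign σ : ℤ) : ℂ) *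
      LinearMap.trace ℂ V (stepProd (fun q v => c q v) fun m => w (σ m)) := by
  rw [traceForm, MultilinearMap.alternatization_apply]
  refine Finset.sum_congr rfl fun σ _ => ?_
  rw [Units.smul_def, zsmul_eq_mul]
  simp [stepProd, MultilinearMap.mkPiAlgebraFin_apply]

theorem sum_traceForm_succAbove {ℓ : ℕ} (c : Fin (ℓ + 2) → T →ₗ[ℂ] Module.End ℂ V) :
    ∑ j : Fin (ℓ + 2), (-1 : ℤ) ^ (j : ℕ) • traceForm (fun q => c (j.succAbove q)) = 0 := by
  ext w
  have h : ∀ σ : Equiv.Perm (Fin ℓ), ∑ j : Fin (ℓ + 2), (-1 : ℤ) ^ (j : ℕ) •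
      LinearMap.trace ℂ V (stepProd (fun q v => c (j.succAbove q) v) fun m => w (σ m)) = 0 := by
    intro σ
    simp only [← map_zsmul, ← map_sum]
    rw [sum_stepProd_succAbove (fun q v => c q v), map_zero]
  let ev : (T [⋀^Fin ℓ]→ₗ[ℂ] ℂ) →+ ℂ :=
    { toFun := fun η => η w, map_zero' := rfl, map_add' := fun _ _ => rfl }
  change ev _ = 0
  rw [map_sum]
  simp only [map_zsmul]
  change ∑ j : Fin (ℓ + 2), (-1 : ℤ) ^ (j : ℕ) • traceForm (fun q => c (j.succAbove q)) w = 0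
  simp only [traceForm_apply, Finset.smul_sum]
  rw [Finset.sum_comm]
  refine Finset.sum_eq_zero fun σ _ => ?_
  simp only [← mul_smul_comm, ← Finset.mul_sum, h, mul_zero]

theorem traceForm_eq_zero {ℓ : ℕ} (c : Fin (ℓ + 1) → T →ₗ[ℂ] Module.End ℂ V) (j : Fin ℓ)
    (h : c j.castSucc = c j.succ) : traceForm c = 0 := by
  ext w
  rw [traceForm_apply]
  refine Finset.sum_eq_zero fun σ _ => ?_
  rw [stepProd_eq_zero _ _ j (by rw [h]), map_zero, mul_zero]

end TraceForm

/-! ### The trace form of a chain of isomorphisms -/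

namespace HVBObj
variable {U : CMan.{u}}

/-- If all spaces of a chain are identified with `W`, then the composite of the chain becomes the
product of the corresponding endomorphisms of `W`. -/
theorem symm_comp_compChain_comp {W : Type u} [AddCommGroup W] [Module ℂ W] {ℓ : ℕ}
    (V : Fin (ℓ + 1) → Type u) [∀ j, AddCommGroup (V j)] [∀ j, Module ℂ (V j)]
    (A : ∀ j : Fin ℓ, V j.castSucc →ₗ[ℂ] V j.succ) (g : ∀ j, W ≃ₗ[ℂ] V j) :
    (g (Fin.last ℓ)).symm.toLinearMap ∘ₗ compChain ℓ V A ∘ₗ (g 0).toLinearMap =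
      (List.ofFn fun m : Fin ℓ => ((g m.rev.succ).symm.toLinearMap ∘ₗ A m.rev ∘ₗ
        (g m.rev.castSucc).toLinearMap : Module.End ℂ W)).prod := by
  induction ℓ with
  | zero =>
    ext a
    simp [compChain]
  | succ ℓ ih =>
    have h := ih (fun j => V j.castSucc) (fun j => A j.castSucc) (fun j => g j.castSucc)
    rw [List.ofFn_succ, List.prod_cons]
    have e : ∀ m : Fin ℓ, ((g m.succ.rev.succ).symm.toLinearMap ∘ₗ A m.succ.rev ∘ₗ
        (g m.succ.rev.castSucc).toLinearMap : Module.End ℂ W) =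
        ((g m.rev.succ.castSucc).symm.toLinearMap ∘ₗ A m.rev.castSucc ∘ₗ
        (g m.rev.castSucc.castSucc).toLinearMap : Module.End ℂ W) := by
      intro m
      rw [Fin.rev_succ]
      rfl
    simp only [e]
    refine Eq.trans ?_ (congrArg₂ (· * ·) rfl h)
    rw [Fin.rev_zero]
    ext a
    simp only [Module.End.mul_apply, LinearMap.comp_apply, compChain, LinearEquiv.coe_coe,
      LinearEquiv.apply_symm_apply]
    rfl

theorem exists_isHol_apply_eq (E : HolBundle U) (x : U) (a : E.fib x) :
    ∃ s : ∀ y, E.fib y, E.IsHol s x ∧ s x = a := by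
  obtain ⟨r, e, he⟩ := E.locallyFree x
  replace he : E.IsFrame e x := he
  refine ⟨fun y => ∑ i, he.basis.repr a i • e i y,
    HolBundle.isHol_sum (fun i => CMan.HolAt.const _ _) he.isHol, ?_⟩
  simp only [← he.basis_apply]
  exact he.basis.sum_repr a

theorem nablaHom_apply {E F : HVBObj U} (f : E ⟶ F) {x : U} {s : ∀ y, E.bundle.fib y}
    (hs : E.bundle.IsHol s x) (v : U.T x) :
    nablaHom f x v (s x) = F.conn.nabla (fun y => fibIso f y (s y)) x v
          - fibIso f x (E.conn.nabla s x v) :=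
  (existsUnique_nablaHom f x).choose_spec.1 s hs v

/-- The Leibniz rule for the induced connections on `Hom` bundles. -/
theorem nablaHom_comp {E F G : HVBObj U} (f : E ⟶ F) (g : F ⟶ G) (x : U) (v : U.T x) :
    nablaHom (f ≫ g) x v = nablaHom g x v ∘ₗ (fibIso f x).toLinearMap +
      (fibIso g x).toLinearMap ∘ₗ nablaHom f x v := by
  ext a
  obtain ⟨s, hs, rfl⟩ := exists_isHol_apply_eq E.bundle x a
  have h := nablaHom_apply g (isHol_fibIso f hs) v
  simp only [LinearMap.add_apply, LinearMap.comp_apply, LinearEquiv.coe_coe]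
  rw [nablaHom_apply _ hs, nablaHom_apply _ hs, h, map_sub]
  exact (sub_add_sub_cancel _ _ _).symm

/-- The endomorphism-valued 1-form `g⁻¹ ∘ ∇ g` of an isomorphism `g : B → E`: the connection of `E`,
transported to `B`, minus the connection of `B`. -/
noncomputable def connForm {B E : HVBObj U} (g : B ⟶ E) (x : U) :
    U.T x →ₗ[ℂ] Module.End ℂ (B.bundle.fib x) :=
  (nablaHom g x).compr₂ (fibIso g x).symm.toLinearMap

theorem connForm_comp {B E F : HVBObj U} (g : B ⟶ E) (f : E ⟶ F) (x : U) (v : U.T x) :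
    connForm (g ≫ f) x v - connForm g x v = (fibIso (g ≫ f) x).symm.toLinearMap ∘ₗ
      nablaHom f x v ∘ₗ (fibIso g x).toLinearMap := by
  rw [sub_eq_iff_eq_add]
  ext a
  have h : ∀ b, (fibIso (g ≫ f) x).symm b = (fibIso g x).symm ((fibIso f x).symm b) := fun _ => rfl
  simp [connForm, nablaHom_comp, h]

theorem trace_one_fib (E : HolBundle U) (x : U) :
    LinearMap.trace ℂ (E.fib x) 1 = Module.finrank ℂ (E.fib x) := by
  obtain ⟨r, e, he⟩ := E.locallyFree x
  replace he : E.IsFrame e x := he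
  have := Module.Free.of_basis he.basis
  have := Module.Finite.of_basis he.basis
  exact LinearMap.trace_one ℂ _

/-- The coefficient that `Ch` assigns to a cell may be computed in the fibres of any bundle `B` that is
compatibly isomorphic to the bundles of the chain. For `ℓ = 0` it says that the trace of the identity
is the rank. -/
theorem chCoeff_eq_traceForm {k : ℕ} (E : ComposableArrows (HVBObj U) k) {ℓ : ℕ}
    (i : Fin (ℓ + 1) ↪o Fin (k + 1)) {B : HVBObj U} (g : ∀ q, B ⟶ E.obj (i q))
    (hg : ∀ (p q : Fin (ℓ + 1)) (h : p ≤ q), g p ≫ tilde E (i.monotone h) = g q)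
    (x : U) (w : Fin ℓ → U.T x) :
    chCoeff E ℓ i x w = traceForm (fun q => connForm (g q) x) w := by
  rw [traceForm_apply]
  cases ℓ with
  | zero =>
    simp [chCoeff, stepProd_zero, trace_one_fib, (fibIso (g 0) x).finrank_eq]
  | succ ℓ =>
    refine Finset.sum_congr rfl fun σ _ => congrArg _ ?_
    have h := symm_comp_compChain_comp (fun j => (E.obj (i j)).bundle.fib x) (fun j =>
      nablaHom (tilde E (i.monotone (Fin.castSucc_lt_succ (i := j)).le)) x (w (σ j.rev)))
      (fun j => fibIso (g j) x)
    have e : (List.ofFn fun m : Fin (ℓ + 1) => ((fibIso (g m.rev.succ) x).symm.toLinearMap ∘ₗ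
        nablaHom (tilde E (i.monotone (Fin.castSucc_lt_succ (i := m.rev)).le)) x
          (w (σ m.rev.rev)) ∘ₗ (fibIso (g m.rev.castSucc) x).toLinearMap :
          Module.End ℂ (B.bundle.fib x))).prod =
        stepProd (fun q v => connForm (g q) x v) fun m => w (σ m) := by
      rw [stepProd]
      congr 2
      funext m
      rw [Fin.rev_rev, ← hg _ _ (Fin.castSucc_lt_succ (i := m.rev)).le, connForm_comp]
    rw [← e]
    refine Eq.trans ?_ (congrArg _ h)
    -- The two composites agree up to conjugation by `g 0 : B → E_{i_0}`.
    rw [← LinearMap.trace_conj' _ (fibIso (g 0) x).symm]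
    congr 1
    ext a
    rw [← hg 0 _ (Fin.zero_le (Fin.last (ℓ + 1)))]
    rfl
end HVBObj

namespace HVBObj
variable {U V : CMan.{u}}

/-! ### Holomorphy of the trace forms -/

theorem isHol_eventually {E : HolBundle U} {s : ∀ y, E.fib y} {x : U} (hs : E.IsHol s x) :
    ∀ᶠ y in 𝓝 x, E.IsHol s y := by
  obtain ⟨r, e, he⟩ := E.locallyFree x
  replace he : E.IsFrame e x := he
  obtain ⟨c, hc, h⟩ := (he.isHol_iff s).1 hs
  filter_upwards [he.eventually, Filter.eventually_all.2 fun i => (hc i).eventually,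
    eventually_eventually_nhds.2 h] with y h1 h2 h3
  exact (h1.isHol_iff s).2 ⟨c, h2, h3⟩

theorem isHol_nablaHom {E F : HVBObj U} (f : E ⟶ F) {s : ∀ y, E.bundle.fib y} {x : U}
    (hs : E.bundle.IsHol s x) {v : ∀ y : U, U.T y} (hv : HolVF v x) :
    F.bundle.IsHol (fun y => nablaHom f y (v y) (s y)) x := by
  have h1 := F.conn.isHol (isHol_fibIso f hs) v hv
  have h2 := isHol_fibIso f (E.conn.isHol hs v hv)
  refine HolBundle.isHol_congr
    (HolBundle.isHol_add h1 (HolBundle.isHol_smul (HolAt.const (-1) x) h2)) ?_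
  filter_upwards [isHol_eventually hs] with y hy
  rw [nablaHom_apply f hy, neg_one_smul, sub_eq_add_neg]

/-- The family `A` of endomorphisms of the fibres of `E` takes holomorphic sections near `x` to
holomorphic sections near `x`. -/
def IsHolEnd (E : HolBundle U) (A : ∀ y, Module.End ℂ (E.fib y)) (x : U) : Prop :=
  ∀ s : ∀ y, E.fib y, E.IsHol s x → E.IsHol (fun y => A y (s y)) x

theorem IsHolEnd.sub {E : HolBundle U} {A B : ∀ y, Module.End ℂ (E.fib y)} {x : U}
    (hA : IsHolEnd E A x) (hB : IsHolEnd E B x) : IsHolEnd E (fun y => A y - B y) x :=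
    fun s hs => by
  have := HolBundle.isHol_add (hA s hs) (HolBundle.isHol_smul (HolAt.const (-1) x) (hB s hs))
  simpa [sub_eq_add_neg] using this

theorem isHolEnd_connForm {B E : HVBObj U} (g : B ⟶ E) {x : U} {v : ∀ y : U, U.T y}
    (hv : HolVF v x) : IsHolEnd B.bundle (fun y => connForm g y (v y)) x := fun s hs => by
  have h := isHol_nablaHom g hs hv
  refine (BundleIso.isHol_iff g _ x).1 ?_
  simpa [connForm] using h

theorem isHolEnd_stepProd {E : HolBundle U} {ℓ : ℕ}
    (c : ∀ y, Fin (ℓ + 1) → U.T y → Module.End ℂ (E.fib y)) (w : Fin ℓ → ∀ y : U, U.T y) {x : U}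
    (h : ∀ q m, IsHolEnd E (fun y => c y q (w m y)) x) :
    IsHolEnd E (fun y => stepProd (c y) fun m => w m y) x := by
  induction ℓ with
  | zero =>
    intro s hs
    simpa [stepProd_zero] using hs
  | succ ℓ ih =>
    intro s hs
    simp only [stepProd_succ]
    exact (h _ _).sub (h _ _) _
      (ih (fun y q => c y q.castSucc) (fun m => w m.succ) (fun q m => h _ _) s hs)

theorem IsHolEnd.holAt_trace {E : HolBundle U} {A : ∀ y, Module.End ℂ (E.fib y)} {x : U}
    (hA : IsHolEnd E A x) : HolAt (fun y => LinearMap.trace ℂ (E.fib y) (A y)) x := by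
  obtain ⟨r, e, he⟩ := E.locallyFree x
  replace he : E.IsFrame e x := he
  choose c hc h using fun j => (he.isHol_iff _).1 (hA (e j) (he.isHol j))
  refine (HolAt.sum Finset.univ fun i => hc i i).congr ?_
  filter_upwards [he.eventually, Filter.eventually_all.2 h] with y hy hy'
  rw [LinearMap.trace_eq_matrix_trace ℂ hy.basis, Matrix.trace]
  refine Finset.sum_congr rfl fun i _ => ?_
  rw [Matrix.diag_apply, LinearMap.toMatrix_apply, hy.basis_apply, hy']
  simp only [← hy.basis_apply]
  rw [hy.basis.repr_sum_self]

theorem holAt_traceForm {B : HVBObj U} {ℓ : ℕ} {E : Fin (ℓ + 1) → HVBObj U} (g : ∀ q, B ⟶ E q)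
    {x : U} {v : Fin ℓ → ∀ y : U, U.T y} (hv : ∀ m, HolVF (v m) x) :
    HolAt (fun y => traceForm (fun q => connForm (g q) y) fun m => v m y) x := by
  simp only [traceForm_apply]
  refine HolAt.sum _ fun σ => (HolAt.const _ _).mul (IsHolEnd.holAt_trace ?_)
  exact isHolEnd_stepProd (fun y q v => connForm (g q) y v) (fun m => v (σ m))
    fun q m => isHolEnd_connForm (g q) (hv _)

/-- The holomorphic `ℓ`-form that `Ch` assigns to the top cell of a chain `E_0 → ⋯ → E_ℓ`, computed in
the fibres of `E_0`. -/
noncomputable def chForm {ℓ : ℕ} (D : ComposableArrows (HVBObj U) ℓ) : HolForm U ℓ :=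
  ⟨fun x => traceForm fun q => connForm (tilde D (Fin.zero_le q)) x,
    fun _ _ hv => holAt_traceForm _ hv⟩

/-- The chain `E_{i_0} → ⋯ → E_{i_ℓ}` obtained from `E_0 → ⋯ → E_k` and a monotone map `i`. It is
definitionally the action of `i` on the nerve. -/
def restrict {k ℓ : ℕ} (E : ComposableArrows (HVBObj U) k) (i : Fin (ℓ + 1) →o Fin (k + 1)) :
    ComposableArrows (HVBObj U) ℓ := i.monotone.functor ⋙ E

/-! ### Faces, degeneracies and pullback -/

theorem tilde_comp {k : ℕ} (E : ComposableArrows (HVBObj U) k) {p q r : Fin (k + 1)} (h : p ≤ q)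
    (h' : q ≤ r) : tilde E h ≫ tilde E h' = tilde E (h.trans h') :=
  (E.map_comp _ _).symm

theorem chForm_eq_chCoeff {k : ℕ} (E : ComposableArrows (HVBObj U) k) {ℓ : ℕ}
    (i : Fin (ℓ + 1) ↪o Fin (k + 1)) (x : U) (w : Fin ℓ → U.T x) :
    (chForm (restrict E i.toOrderHom)).1 x w = chCoeff E ℓ i x w :=
  (chCoeff_eq_traceForm E i (fun q => tilde (restrict E i.toOrderHom) (Fin.zero_le q))
    (fun p _ h => tilde_comp (restrict E i.toOrderHom) (Fin.zero_le p) h) x w).symm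

/-- The form of a restricted chain, computed with the base `E_0` of the full chain. This puts
all faces and degeneracies of a chain over the same bundle. -/
theorem chForm_restrict_apply {k ℓ : ℕ} (E : ComposableArrows (HVBObj U) k)
    (i : Fin (ℓ + 1) →o Fin (k + 1)) (x : U) (w : Fin ℓ → U.T x) :
    (chForm (restrict E i)).1 x w =
      traceForm (fun q => connForm (tilde E (Fin.zero_le (i q))) x) w := by
  have h1 := chCoeff_eq_traceForm (restrict E i) (OrderIso.refl (Fin (ℓ + 1))).toOrderEmbedding
    (fun q => tilde (restrict E i) (Fin.zero_le q))
    (fun p q h => tilde_comp (restrict E i) (Fin.zero_le p) h) x w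
  have h2 := chCoeff_eq_traceForm (restrict E i) (OrderIso.refl (Fin (ℓ + 1))).toOrderEmbedding
    (fun q => tilde E (Fin.zero_le (i q)))
    (fun p q h => tilde_comp E (Fin.zero_le (i p)) (i.monotone h)) x w
  exact h1.symm.trans h2

theorem sum_chForm_succAbove {ℓ : ℕ} (D : ComposableArrows (HVBObj U) (ℓ + 1)) :
    ∑ j : Fin (ℓ + 2), (-1 : ℤ) ^ (j : ℕ) •
      chForm (restrict D (Fin.succAboveOrderEmb j).toOrderHom) = 0 := by
  apply Subtype.ext
  funext x
  have h := sum_traceForm_succAbove fun q => connForm (tilde D (Fin.zero_le q)) x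
  let ev : HolForm U ℓ →+ ((U.T x) [⋀^Fin ℓ]→ₗ[ℂ] ℂ) :=
    { toFun := fun η => η.1 x, map_zero' := rfl, map_add' := fun _ _ => rfl }
  change ev _ = 0
  rw [map_sum, ← h]
  refine Finset.sum_congr rfl fun j _ => ?_
  rw [map_zsmul]
  congr 1
  ext w
  exact chForm_restrict_apply D _ x w

theorem chForm_restrict_eq_zero {k ℓ : ℕ} (E : ComposableArrows (HVBObj U) k)
    (i : Fin (ℓ + 1) →o Fin (k + 1)) (j : Fin ℓ) (h : i j.castSucc = i j.succ) :
    chForm (restrict E i) = 0 := by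
  apply Subtype.ext
  funext x
  ext w
  rw [chForm_restrict_apply, traceForm_eq_zero _ j]
  · rfl
  · have : ∀ p q : Fin (k + 1), p = q →
        connForm (tilde E (Fin.zero_le p)) x = connForm (tilde E (Fin.zero_le q)) x := by
      rintro p _ rfl; rfl
    exact this _ _ h

theorem nablaHom_pullback (φ : HolMap U V) {E F : HVBObj V} (f : E ⟶ F) (x : U) (v : U.T x) :
    nablaHom ((pullback φ).map f) x v = nablaHom f (φ x) (dMap φ x v) := by
  refine LinearMap.ext fun a => ?_
  obtain ⟨s, hs, rfl⟩ := exists_isHol_apply_eq E.bundle (φ x) a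
  refine Eq.trans ?_ (nablaHom_apply f hs _).symm
  refine (nablaHom_apply ((pullback φ).map f) (s := fun y => s (φ y))
    (HolBundle.pullbackIsHol_comp φ E.bundle hs) v).trans ?_
  refine congrArg₂ (· - ·) ?_ (congrArg _ ?_)
  · exact HolConnection.pullbackNabla_comp φ F.conn (isHol_fibIso f hs) v
  · exact HolConnection.pullbackNabla_comp φ E.conn hs v

theorem chForm_pullback (φ : HolMap U V) {ℓ : ℕ} (D : ComposableArrows (HVBObj V) ℓ) :
    chForm (D ⋙ pullback φ) = HolForm.pullback φ ℓ (chForm D) := by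
  apply Subtype.ext
  funext x
  ext w
  change traceForm (fun q => connForm ((pullback φ).map (tilde D (Fin.zero_le q))) x) w =
    traceForm (fun q => connForm (tilde D (Fin.zero_le q)) (φ x)) fun m => dMap φ x (w m)
  rw [traceForm_apply, traceForm_apply]
  refine Finset.sum_congr rfl fun σ _ => congrArg _ (congrArg _ ?_)
  have h : ∀ q v, connForm ((pullback φ).map (tilde D (Fin.zero_le q))) x v =
      connForm (tilde D (Fin.zero_le q)) (φ x) (dMap φ x v) := fun q v =>
    congrArg (fun A => (fibIso (tilde D (Fin.zero_le q)) (φ x)).symm.toLinearMap ∘ₗ A)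
      (nablaHom_pullback φ (tilde D (Fin.zero_le q)) x v)
  unfold stepProd
  simp only [h]
  rfl
end HVBObj

/-! ### Maps out of normalized chains -/

section
open CMan Simplicial Limits

section NormalizedChains

/-- The coefficient group `ℤ` of the normalized chains. -/
abbrev ULiftInt : AddCommGrpCat.{u} := AddCommGrpCat.of (ULift.{u} ℤ)

/-- The homomorphism `ℤ → G` that sends `1` to `a`. -/
noncomputable def genHom {G : AddCommGrpCat.{u}} (a : G) : ULiftInt.{u} ⟶ G :=
  AddCommGrpCat.ofHom ((zmultiplesHom G a).comp AddEquiv.ulift.toAddMonoidHom)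

theorem genHom_apply {G : AddCommGrpCat.{u}} (a : G) : (genHom a).hom (ULift.up 1) = a :=
  one_zsmul a

theorem genHom_ext {G : AddCommGrpCat.{u}} {f g : ULiftInt.{u} ⟶ G}
    (h : f.hom (ULift.up 1) = g.hom (ULift.up 1)) : f = g := by
  ext ⟨n⟩
  have e : (ULift.up n : ULift.{u} ℤ) = n • ULift.up 1 := by
    ext; simp
  rw [e, map_zsmul, map_zsmul]
  exact congrArg (n • ·) h

theorem genHom_comp {G H : AddCommGrpCat.{u}} (a : G) (f : G ⟶ H) :
    genHom a ≫ f = genHom (f.hom a) :=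
  genHom_ext (by rw [genHom_apply]; exact congrArg f.hom (genHom_apply a))

theorem genHom_zero {G : AddCommGrpCat.{u}} : genHom (0 : G) = 0 :=
  genHom_ext (genHom_apply _)

theorem sum_zsmul_genHom {G : AddCommGrpCat.{u}} {ι : Type*} (t : Finset ι) (n : ι → ℤ)
    (a : ι → G) :
    ∑ i ∈ t, n i • genHom (a i) = genHom (∑ i ∈ t, n i • a i) := by
  refine genHom_ext ?_
  rw [genHom_apply]
  let ev : (ULiftInt.{u} ⟶ G) →+ G :=
    { toFun := fun f => f.hom (ULift.up 1), map_zero' := rfl, map_add' := fun _ _ => rfl }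
  change ev _ = _
  simp only [map_sum, map_zsmul]
  exact Finset.sum_congr rfl fun i _ => congrArg (n i • ·) (genHom_apply (a i))

variable (X : SSet.{u}) (K : ChainComplex AddCommGrpCat.{u} ℕ) (val : ∀ ℓ : ℕ, X _⦋ℓ⦌ → K.X ℓ)

/-- The homomorphism on normalized `ℓ`-chains with prescribed values on the nondegenerate simplices. -/
noncomputable def normDesc (ℓ : ℕ) : (X.normalizedChainComplex ULiftInt.{u}).X ℓ ⟶ K.X ℓ :=
  Cofan.IsColimit.desc (X.isColimitCofanNormalizedChainComplex ULiftInt.{u} ℓ)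
    fun x => genHom (val ℓ x.1)

/-- If the prescribed values vanish on degenerate simplices, then they are attained on all simplices. -/
theorem ι_normDesc (h0 : ∀ ℓ, ∀ x ∈ X.degenerate ℓ, val ℓ x = 0) {ℓ : ℕ} (x : X _⦋ℓ⦌) :
    X.ιNormalizedChainComplex (R := ULiftInt.{u}) x ≫ normDesc X K val ℓ = genHom (val ℓ x) := by
  by_cases hx : x ∈ X.nonDegenerate ℓ
  · exact Cofan.IsColimit.fac (X.isColimitCofanNormalizedChainComplex ULiftInt.{u} ℓ)
      (fun x => genHom (val ℓ x.1)) ⟨x, hx⟩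
  · have hx' := (X.mem_degenerate_iff_notMem_nonDegenerate x).2 hx
    rw [SSet.ιNormalizedChainComplex_eq_zero _ _ hx', h0 ℓ x hx', zero_comp, genHom_zero]

/-- The chain map on normalized chains given by values on simplices that vanish on degenerate simplices
and are compatible with the differentials. -/
noncomputable def normLift (h0 : ∀ ℓ, ∀ x ∈ X.degenerate ℓ, val ℓ x = 0)
    (hd : ∀ ℓ (x : X _⦋ℓ + 1⦌), (K.d (ℓ + 1) ℓ).hom (val (ℓ + 1) x) =
      ∑ j : Fin (ℓ + 2), (-1 : ℤ) ^ (j : ℕ) • val ℓ (X.δ j x)) :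
    X.normalizedChainComplex ULiftInt.{u} ⟶ K where
  f := normDesc X K val
  comm' m n h := by
    obtain rfl : n + 1 = m := h
    refine SSet.normalizedChainComplex_hom_ext _ fun x _ => ?_
    rw [← Category.assoc, ι_normDesc X K val h0, genHom_comp, hd, ← sum_zsmul_genHom,
      ← Category.assoc, SSet.ιNormalizedChainComplex_d, Preadditive.sum_comp]
    refine Finset.sum_congr rfl fun j _ => ?_
    rw [Preadditive.zsmul_comp, ι_normDesc X K val h0]

end NormalizedChains

/-! ### The map `Ch` -/

namespace HVBObj
variable {U V : CMan.{u}}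

theorem QFunctor_obj_OmegaHol_d (m n : ℕ) :
    (QFunctor.obj (OmegaHol.obj (op U))).d m n = 0 := by
  by_cases h : n + 1 = m
  · subst h
    have h0 : ∀ j, (OmegaHol.obj (op U)).d j (j + 1) = 0 := fun _ => rfl
    simp only [QFunctor]
    rw [ChainComplex.of_d]
    ext a x
    simp only [h0, AddCommGrpCat.hom_zero]
    simp
    rfl
  · exact HomologicalComplex.shape _ _ _ h

/-- The map `η ↦ η · u^ℓ` as a group homomorphism. -/
noncomputable def formMulUPowHom (U : CMan.{u}) (ℓ : ℕ) :
    HolForm U ℓ →+ (QFunctor.obj (OmegaHol.obj (op U))).X ℓ :=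
  DirectSum.of (fun a : QIndex ℓ => HolForm U a.1.1) ⟨(ℓ, ℓ), by lia⟩

/-- The value of `Ch (E_0 → ⋯ → E_k)` on an arbitrary simplex of `Δ^k`, degenerate or not. -/
noncomputable def chValue {k : ℕ} (E : ComposableArrows (HVBObj U) k) {ℓ : ℕ}
    (x : (Δ[k] : SSet.{u}) _⦋ℓ⦌) : (QFunctor.obj (OmegaHol.obj (op U))).X ℓ :=
  formMulUPow (chForm (restrict E (SSet.stdSimplex.objEquiv x).toOrderHom))

theorem chValue_eq_zero {k : ℕ} (E : ComposableArrows (HVBObj U) k) {ℓ : ℕ}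
    (x : (Δ[k] : SSet.{u}) _⦋ℓ⦌) (hx : x ∈ (Δ[k] : SSet.{u}).degenerate ℓ) : chValue E x = 0 := by
  cases ℓ with
  | zero => simp at hx
  | succ ℓ =>
    simp only [SSet.degenerate_eq_iUnion_range_σ, Set.mem_iUnion, Set.mem_range] at hx
    obtain ⟨j, y, rfl⟩ := hx
    rw [chValue, chForm_restrict_eq_zero E _ j]
    · exact map_zero (formMulUPowHom U (ℓ + 1))
    · refine congrArg (SSet.stdSimplex.objEquiv y).toOrderHom ?_
      exact (Fin.predAbove_castSucc_self j).trans (Fin.predAbove_succ_self j).symm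

theorem sum_chValue_δ {k : ℕ} (E : ComposableArrows (HVBObj U) k) {ℓ : ℕ}
    (x : (Δ[k] : SSet.{u}) _⦋ℓ + 1⦌) :
    ∑ j : Fin (ℓ + 2), (-1 : ℤ) ^ (j : ℕ) • chValue E ((Δ[k] : SSet.{u}).δ j x) = 0 := by
  have h := congrArg (formMulUPowHom U ℓ)
    (sum_chForm_succAbove (restrict E (SSet.stdSimplex.objEquiv x).toOrderHom))
  rw [map_sum, map_zero] at h
  rw [← h]
  refine Finset.sum_congr rfl fun j _ => ?_
  rw [map_zsmul]
  rfl

/-- The chain map `Ch (E_0 → ⋯ → E_k)`. -/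
noncomputable def chMap {k : ℕ} (E : ComposableArrows (HVBObj U) k) :
    NZDelta.{u}.obj (SimplexCategory.mk k) ⟶ QFunctor.obj (OmegaHol.obj (op U)) :=
  normLift (Δ[k] : SSet.{u}) _ (fun _ x => chValue E x) (fun _ x hx => chValue_eq_zero E x hx)
    fun ℓ x => by
      rw [QFunctor_obj_OmegaHol_d, sum_chValue_δ]
      rfl

theorem ι_chMap {k : ℕ} (E : ComposableArrows (HVBObj U) k) {ℓ : ℕ}
    (x : (Δ[k] : SSet.{u}) _⦋ℓ⦌) :
    SSet.ιNormalizedChainComplex (R := ULiftInt.{u}) (Δ[k] : SSet.{u}) x ≫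
      (chMap E).f ℓ = genHom (chValue E x) :=
  ι_normDesc _ _ _ (fun _ x hx => chValue_eq_zero E x hx) x

theorem chMap_ext {k : ℕ} {K : ChainComplex AddCommGrpCat.{u} ℕ}
    {f g : NZDelta.{u}.obj (SimplexCategory.mk k) ⟶ K}
    (h : ∀ (ℓ : ℕ) (x : (Δ[k] : SSet.{u}) _⦋ℓ⦌), x ∈ (Δ[k] : SSet.{u}).nonDegenerate ℓ →
      SSet.ιNormalizedChainComplex (R := ULiftInt.{u}) (Δ[k] : SSet.{u}) x ≫ f.f ℓ =
      SSet.ιNormalizedChainComplex (R := ULiftInt.{u}) (Δ[k] : SSet.{u}) x ≫ g.f ℓ) : f = g := by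
  refine HomologicalComplex.Hom.ext (funext fun ℓ => ?_)
  exact SSet.normalizedChainComplex_hom_ext _ (h ℓ)

theorem ι_NZDelta_map {k m : ℕ} (θ : SimplexCategory.mk m ⟶ SimplexCategory.mk k) {ℓ : ℕ}
    (x : (Δ[m] : SSet.{u}) _⦋ℓ⦌) :
    SSet.ιNormalizedChainComplex (R := ULiftInt.{u}) (Δ[m] : SSet.{u}) x ≫ (NZDelta.{u}.map θ).f ℓ =
      SSet.ιNormalizedChainComplex (R := ULiftInt.{u}) (Δ[k] : SSet.{u})
        ((SSet.stdSimplex.{u}.map θ).app _ x) :=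
  SSet.ι_normalizedChainComplexMap_f (SSet.stdSimplex.{u}.map θ) ULiftInt.{u} x

theorem chValue_restrict {k m : ℕ} (E : ComposableArrows (HVBObj U) k)
    (θ : SimplexCategory.mk m ⟶ SimplexCategory.mk k) {ℓ : ℕ} (x : (Δ[m] : SSet.{u}) _⦋ℓ⦌) :
    chValue (restrict E θ.toOrderHom) x = chValue E ((SSet.stdSimplex.{u}.map θ).app _ x) := rfl

theorem chMap_restrict {k m : ℕ} (E : ComposableArrows (HVBObj U) k)
    (θ : SimplexCategory.mk m ⟶ SimplexCategory.mk k) :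
    chMap (restrict E θ.toOrderHom) = NZDelta.{u}.map θ ≫ chMap E := by
  refine chMap_ext fun ℓ x _ => ?_
  rw [ι_chMap, chValue_restrict, ← ι_chMap, ← ι_NZDelta_map]
  exact Category.assoc _ _ _

theorem chValue_pullback (φ : HolMap U V) {k : ℕ} (E : ComposableArrows (HVBObj V) k) {ℓ : ℕ}
    (x : (Δ[k] : SSet.{u}) _⦋ℓ⦌) :
    ((QFunctor.map (OmegaHol.map (show U ⟶ V from φ).op)).f ℓ).hom (chValue E x) =
      chValue (E ⋙ pullback φ) x := by
  refine (DirectSum.map_of _ _ _).trans ?_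
  refine Eq.trans ?_ (congrArg formMulUPow (chForm_pullback φ
    (restrict E (SSet.stdSimplex.objEquiv x).toOrderHom)).symm)
  rfl

theorem chMap_pullback (φ : HolMap U V) {k : ℕ} (E : ComposableArrows (HVBObj V) k) :
    chMap (E ⋙ pullback φ) = chMap E ≫ QFunctor.map (OmegaHol.map (show U ⟶ V from φ).op) := by
  refine chMap_ext fun ℓ x _ => ?_
  rw [ι_chMap, ← chValue_pullback, ← genHom_comp, ← ι_chMap]
  exact Category.assoc _ _ _

/-- The map `Ch` of simplicial presheaves. -/
noncomputable def chern : HVB.{u} ⟶ Omega.{u} where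
  app U :=
    { app := fun Δ => TypeCat.ofHom fun E => ULift.up (chMap (k := Δ.unop.len) E)
      naturality := fun Δ Δ' θ => by
        ext E
        exact congrArg ULift.up (chMap_restrict (k := Δ.unop.len) (m := Δ'.unop.len) E θ.unop) }
  naturality U V φ := by
    ext Δ E
    exact congrArg ULift.up (chMap_pullback φ.unop (k := Δ.unop.len) E)

theorem chern_spec (U : CMan.{u}) (k : ℕ) (E : ComposableArrows (HVBObj U) k) (ℓ : ℕ)
    (i : Fin (ℓ + 1) ↪o Fin (k + 1)) :
    ∃ η : HolForm U ℓ,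
      (∀ (x : U) (w : Fin ℓ → U.T x), η.1 x w = chCoeff E ℓ i x w) ∧
      (Omega.toChainMap ((chern.app (op U)).app (op (SimplexCategory.mk k)) E)).f ℓ
        (cellGen i) = formMulUPow η := by
  refine ⟨chForm (restrict E i.toOrderHom), chForm_eq_chCoeff E i, ?_⟩
  have h := congrArg (fun f => f.hom (ULift.up 1)) (ι_chMap E
    (SSet.stdSimplex.objEquiv.symm (SimplexCategory.Hom.mk i.toOrderHom)))
  exact h.trans (genHom_apply _)

end HVBObj
end

theorem theorem2p4 :
    ∃! Ch : HVB.{u} ⟶ Omega.{u},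
      ∀ (U : CMan.{u}) (k : ℕ) (E : ComposableArrows (HVBObj U) k) (ℓ : ℕ)
        (i : Fin (ℓ + 1) ↪o Fin (k + 1)),
        ∃ η : HolForm U ℓ,
          (∀ (x : U) (w : Fin ℓ → U.T x), η.1 x w = HVBObj.chCoeff E ℓ i x w) ∧
          (Omega.toChainMap ((Ch.app (op U)).app (op (SimplexCategory.mk k)) E)).f ℓ (cellGen i) =
            formMulUPow η := by
  refine ⟨HVBObj.chern, HVBObj.chern_spec, fun Ch hCh => ?_⟩
  ext ⟨U⟩ ⟨Δ⟩ E
  induction Δ using SimplexCategory.rec with | _ k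
  refine ULift.ext _ _ (HVBObj.chMap_ext fun ℓ x hx => ?_)
  obtain ⟨i, rfl⟩ : ∃ i : Fin (ℓ + 1) ↪o Fin (k + 1),
      SSet.stdSimplex.objEquiv.symm (SimplexCategory.Hom.mk i.toOrderHom) = x :=
    ⟨SSet.stdSimplex.nonDegenerateEquiv ⟨x, hx⟩, congrArg Subtype.val
      (SSet.stdSimplex.nonDegenerateEquiv.symm_apply_apply ⟨x, hx⟩)⟩
  obtain ⟨η, h1, h2⟩ := hCh U k E ℓ i
  obtain ⟨η', h1', h2'⟩ := HVBObj.chern_spec U k E ℓ i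
  have hη : η = η' := Subtype.ext (funext fun y => AlternatingMap.ext fun w =>
    (h1 y w).trans (h1' y w).symm)
  exact genHom_ext (h2.trans ((congrArg formMulUPow hη).trans h2'.symm))
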